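/- Define functions $h_J$ of $1+J$ real variables recursively by $h_0(\eta)=1$ and, for $J\ge 1$, $$h_J(\eta;\phi_1,\dots,\phi_J)=\frac{1}{\eta-\phi_1-\dots-\phi_J}\sum_{j=0}^{J-1}h_j(\eta;\phi_1,\dots,\phi_j)\,h_{J-j-1}(\eta;\phi_{j+1},\dots,\phi_{J-1}).$$ Let $V:(0,\infty)\to\mathbb R$ be given, for every $x>0$, by $$V(x)=\sum_{k=1}^\infty c_k e^{-i\phi_k x}\gamma_k(x)$$ with $c_k\in\mathbb C$, $\phi_k\in\mathbb R$ and $\gamma_k:(0,\infty)\to\mathbb C$. Let $\eta\in(0,\infty)$ and let $p\ge 2$ be an integer, so that the following conditions hold: (i) $\sup_k \operatorname{Var}(\gamma_k,(0,\infty))<\infty$, where $\operatorname{Var}(\gamma,I)$ denotes the total variation of $\gamma$ on $I$; (ii) $\int_0^\infty\bigl(\sup_k|\gamma_k(x)|\bigr)^p\,dx<\infty$; (iii) $\sum_{k=1}^\infty|c_k|<\infty$; (iv) for every $j=1,\dots,p-1$, one has $\eta\ne\phi_{k_1}+\dots+\phi_{k_j}$ for all $k_1,\dots,k_j\ge 1$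 with $c_{k_1}\cdots c_{k_j}\ne 0$ (so that the expressions below are defined), and $$\sum_{k_1,\dots,k_j=1}^\infty\bigl|c_{k_1}\cdots c_{k_j}\,h_j(\eta;\phi_{k_1},\dots,\phi_{k_j})\bigr|<\infty,$$ where terms with $c_{k_1}\cdots c_{k_j}=0$ are counted as $0$. Then, for $E=\eta^2/4$, every solution $u$ of $$-u''(x)+V(x)u(x)=Eu(x),\qquad x\in(0,\infty),$$ is bounded on $(0,\infty)$. Here a solution is a function $u:(0,\infty)\to\mathbb C$ such that $u$ is differentiable, $u$ and $u'$ are locally absolutely continuous, and the equation holds for almost every $x$. -/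

import Mathlib

open Set MeasureTheory
open scoped ENNReal

/-- The functions `h_J(η; φ_1, …, φ_J)`: `h_0 = 1` and
`h_J(η; φ_1, …, φ_J) = (η - φ_1 - ⋯ - φ_J)⁻¹ *
  ∑_{j=0}^{J-1} h_j(η; φ_1, …, φ_j) * h_{J-j-1}(η; φ_{j+1}, …, φ_{J-1})`,
written here with `J + 1` in place of `J` and with the arguments numbered from `0`.
The value is meaningful only when no divisor that enters the recursion vanishes. -/
noncomputable def smallDivisorH (η : ℝ) : (J : ℕ) → (Fin J → ℝ) → ℝ
  | 0, _ => 1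
  | J + 1, φ =>
      1 / (η - ∑ i, φ i) *
        ∑ j : Fin (J + 1),
          smallDivisorH η j.1 (fun i => φ ⟨i.1, by omega⟩) *
            smallDivisorH η (J - j.1) (fun i => φ ⟨j.1 + i.1, by omega⟩)
termination_by J => J
decreasing_by all_goals omega

/-- The small divisor condition of order `j` at `η`, for the coefficients `c_k` and the
frequencies `φ_k`: the series `∑_{k_1, …, k_j} |c_{k_1} ⋯ c_{k_j} h_j(η; φ_{k_1}, …, φ_{k_j})|`
converges. Its terms have to make sense: the divisor `η - φ_{k_1} - ⋯ - φ_{k_j}` must not vanish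
when all of `c_{k_1}, …, c_{k_j}` are nonzero (a term with a vanishing coefficient counts as `0`).
The other divisors in `h_j` belong to shorter blocks of `k_1, …, k_j`, and so to
the conditions of lower order. -/
def SmallDivisorCondition (c : ℕ → ℂ) (φ : ℕ → ℝ) (η : ℝ) (j : ℕ) : Prop :=
  (∀ k : Fin j → ℕ, (∀ i, c (k i) ≠ 0) → η - ∑ i, φ (k i) ≠ 0) ∧
    Summable fun k : Fin j → ℕ =>
      ‖(∏ i, c (k i)) * (smallDivisorH η j (fun i => φ (k i)) : ℂ)‖

/-- `f` is locally absolutely continuous on `(0, ∞)`: it is absolutely continuous on every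
compact subinterval `[a, b]` of `(0, ∞)`. -/
def LocallyAC (f : ℝ → ℂ) : Prop :=
  ∀ a b : ℝ, 0 < a → a ≤ b → AbsolutelyContinuousOnInterval f a b

/-- `u` solves `-u'' + V u = E u` on `(0, ∞)`: `u` is differentiable on `(0, ∞)`, `u` and `u'` are
locally absolutely continuous there, and the equation holds almost everywhere. -/
structure IsSchrodingerSolution (V : ℝ → ℝ) (E : ℝ) (u : ℝ → ℂ) : Prop where
  differentiableAt : ∀ x : ℝ, 0 < x → DifferentiableAt ℝ u x
  locallyAC : LocallyAC u
  locallyAC_deriv : LocallyAC (deriv u)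
  equation : ∀ᵐ x ∂(volume.restrict (Ioi (0 : ℝ))),
    DifferentiableAt ℝ (deriv u) x ∧
      -(deriv (deriv u) x) + (V x : ℂ) * u x = (E : ℂ) * u x

open ComplexConjugate

/-! For the amplitudes `a = u' + (iη/2)u` and `b = u' - (iη/2)u`, the Schrödinger equation says that
`R = -b/a` satisfies the Riccati equation `R' = -iηR + i(V/η)(1+R)²`. If `r` solves this equation,
then `b + r a` obeys a scalar linear equation, and so does `a + conj r * b`. Since `V` is real, both
squared moduli grow at exactly the rate of `1 - |r|²`, so the quotient `reflectionEnergy` is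
conserved. If `r` solves the equation only up to an error `ε` and `|r| ≤ 1/2`, the energy grows at
rate at most `6|ε|` (`energy_derivative_le`). A small approximate solution with integrable error
therefore bounds `u`.

Such an `r` is built from the functions `h_J`. Let `H_J` be the sum of `z_{k_1} ⋯ z_{k_J} h_J` with
`z_k = c_k e^{-iφ_k x} β_k(x)`. Differentiating `e^{iηx} H_J` brings down the divisor `η - ∑ φ`,
which cancels against `h_J`, and the recursion leaves `(∑ z_k) ∑ H_j H_{J-1-j}` plus terms with
`β'`. Hence `r = ∑_{1 ≤ J ≤ p-1} η^{-J} H_J` solves the Riccati equation up to three errors: terms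
linear in `β'`, products of total degree at least `p` left over from the truncated square, and the
replacement of `V` by `∑ z_k` (`hasDerivAt_riccatiSum`).

As the `γ_k` need not be differentiable, on each interval `[n+1, n+2]` `β_k` interpolates the
endpoint values of `γ_k`. There `|β_k| ≤ S_n + δ_{k,n}`, where `S_n` is `p`-summable and `δ_{k,n}`
is the variation of `γ_k`, summable in `n` uniformly in `k`. All three errors are then bounded by `C
S_n^p` plus a summable sequence (`exists_summable_riccatiDefect_bound`), and the energy estimates on
successive intervals multiply to a finite constant. Near zero, `V` is bounded and Gronwall suffices.
-/

/-! ### Multi-index series and the recursion for `h_J`. -/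

/-- The reindexing of `(k_1, …, k_m, k_{m+1}, …, k_{m+n}, k_{m+n+1})` as a triple of blocks. -/
def splitLastEquiv (m n : ℕ) :
    (Fin (m + n + 1) → ℕ) ≃ ((Fin m → ℕ) × (Fin n → ℕ)) × ℕ :=
  (Fin.succFunEquiv ℕ (m + n)).trans
    (Equiv.prodCongr (Fin.appendEquiv m n).symm (Equiv.refl ℕ))

/-- In the recursion the last frequency occurs only in the divisor. Once the divisor is cleared, the
last index decouples from the two blocks and contributes a factor `∑ w k` of its own. -/
theorem tsum_mul_blocks {m n J : ℕ} (hJ : J = m + n) {f : (Fin m → ℕ) → ℂ}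
    {g : (Fin n → ℕ) → ℂ} {w : ℕ → ℂ} (hf : Summable fun k => ‖f k‖)
    (hg : Summable fun k => ‖g k‖) (hw : Summable fun k => ‖w k‖) :
    (Summable fun k : Fin (J + 1) → ℕ =>
      ‖f (fun i => k ⟨i.1, by omega⟩) * g (fun i => k ⟨m + i.1, by omega⟩) * w (k (Fin.last J))‖) ∧
    ∑' k : Fin (J + 1) → ℕ,
      f (fun i => k ⟨i.1, by omega⟩) * g (fun i => k ⟨m + i.1, by omega⟩) * w (k (Fin.last J)) =
        (∑' k, f k) * (∑' k, g k) * ∑' k, w k := by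
  subst hJ
  have hfg := hf.mul_norm hg
  have hfgw := hfg.mul_norm hw
  constructor
  · exact (splitLastEquiv m n).summable_iff.2 hfgw
  · rw [tsum_mul_tsum_of_summable_norm hf hg, tsum_mul_tsum_of_summable_norm hfg hw,
      ← (splitLastEquiv m n).tsum_eq]
    rfl

/-- The term `z_{k_1} ⋯ z_{k_J} h_J(η; φ_{k_1}, …, φ_{k_J})`. -/
noncomputable def smallDivisorTerm (η : ℝ) (φ : ℕ → ℝ) (z : ℕ → ℂ) (J : ℕ) (k : Fin J → ℕ) : ℂ :=
  (∏ i, z (k i)) * (smallDivisorH η J (fun i => φ (k i)) : ℂ)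

/-- The series `∑ z_{k_1} ⋯ z_{k_J} h_J(η; φ_{k_1}, …, φ_{k_J})`. -/
noncomputable def smallDivisorSum (η : ℝ) (φ : ℕ → ℝ) (z : ℕ → ℂ) (J : ℕ) : ℂ :=
  ∑' k, smallDivisorTerm η φ z J k

theorem divisor_mul_smallDivisorH (η : ℝ) (J : ℕ) (φ : Fin (J + 1) → ℝ)
    (h : η - ∑ i, φ i ≠ 0) :
    (η - ∑ i, φ i) * smallDivisorH η (J + 1) φ =
      ∑ j : Fin (J + 1), smallDivisorH η j.1 (fun i => φ ⟨i.1, by omega⟩) *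
        smallDivisorH η (J - j.1) (fun i => φ ⟨j.1 + i.1, by omega⟩) := by
  rw [smallDivisorH, ← mul_assoc, mul_one_div_cancel h, one_mul]

theorem prod_blocks {m n J : ℕ} (hJ : J = m + n) (z : Fin (J + 1) → ℂ) :
    ∏ i, z i = (∏ i : Fin m, z ⟨i.1, by omega⟩) * (∏ i : Fin n, z ⟨m + i.1, by omega⟩) *
      z (Fin.last J) := by
  subst hJ
  rw [Fin.prod_univ_castSucc, Fin.prod_univ_add]
  rfl

/-- The divisor may vanish at indices where some `c` is zero. There `z` is zero as well, so both
sides vanish whatever value `smallDivisorH` takes. -/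
theorem divisor_mul_smallDivisorTerm {η : ℝ} {φ : ℕ → ℝ} {c z : ℕ → ℂ} {J : ℕ}
    (hne : ∀ k : Fin (J + 1) → ℕ, (∀ i, c (k i) ≠ 0) → η - ∑ i, φ (k i) ≠ 0)
    (hz : ∀ k, c k = 0 → z k = 0) (k : Fin (J + 1) → ℕ) :
    ((η - ∑ i, φ (k i) : ℝ) : ℂ) * smallDivisorTerm η φ z (J + 1) k =
      ∑ j : Fin (J + 1), smallDivisorTerm η φ z j.1 (fun i => k ⟨i.1, by omega⟩) *
        smallDivisorTerm η φ z (J - j.1) (fun i => k ⟨j.1 + i.1, by omega⟩) *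
          z (k (Fin.last J)) := by
  have key : ∀ j : Fin (J + 1), smallDivisorTerm η φ z j.1 (fun i => k ⟨i.1, by omega⟩) *
        smallDivisorTerm η φ z (J - j.1) (fun i => k ⟨j.1 + i.1, by omega⟩) *
          z (k (Fin.last J)) = (∏ i, z (k i)) *
        ((smallDivisorH η j.1 (fun i => φ (k ⟨i.1, by omega⟩)) *
        smallDivisorH η (J - j.1) (fun i => φ (k ⟨j.1 + i.1, by omega⟩)) : ℝ) : ℂ) := by
    intro j
    rw [prod_blocks (m := j.1) (n := J - j.1) (by omega) (fun i => z (k i))]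
    simp only [smallDivisorTerm]
    push_cast
    ring
  rw [Finset.sum_congr rfl fun j _ => key j, ← Finset.mul_sum, smallDivisorTerm]
  by_cases h : ∀ i, c (k i) ≠ 0
  · rw [mul_left_comm, ← Complex.ofReal_mul,
      divisor_mul_smallDivisorH η J (fun i => φ (k i)) (hne k h)]
    push_cast
    rfl
  · push Not at h
    obtain ⟨i, hi⟩ := h
    rw [Finset.prod_eq_zero (Finset.mem_univ i) (hz _ hi)]
    simp

theorem summable_norm_smallDivisorTerm_of_condition {η : ℝ} {φ : ℕ → ℝ} {c : ℕ → ℂ} {q : ℕ}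
    (h : ∀ j, 1 ≤ j → j ≤ q → SmallDivisorCondition c φ η j) {J : ℕ} (hJ : J ≤ q) :
    Summable fun k => ‖smallDivisorTerm η φ c J k‖ := by
  rcases Nat.eq_zero_or_pos J with rfl | hpos
  · exact (hasSum_fintype _).summable
  · exact (h J hpos hJ).2

/-- The bound `b` may depend on the index, so that the variation of each `γ_k` can be summed over
the intervals before the sum over `k` is taken. -/
theorem norm_smallDivisorTerm_le_mul_prod {η : ℝ} {φ : ℕ → ℝ} {c z : ℕ → ℂ} {b : ℕ → ℝ}
    (hz : ∀ k, ‖z k‖ ≤ ‖c k‖ * b k) (J : ℕ) (k : Fin J → ℕ) :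
    ‖smallDivisorTerm η φ z J k‖ ≤ ‖smallDivisorTerm η φ c J k‖ * ∏ i, b (k i) := by
  rw [smallDivisorTerm, smallDivisorTerm, norm_mul, norm_mul, norm_prod, norm_prod]
  calc (∏ i, ‖z (k i)‖) * ‖(smallDivisorH η J (fun i => φ (k i)) : ℂ)‖
      ≤ (∏ i, (‖c (k i)‖ * b (k i))) * ‖(smallDivisorH η J (fun i => φ (k i)) : ℂ)‖ := by
        gcongr with i
        exact hz _
    _ = _ := by
        rw [Finset.prod_mul_distrib]
        ring

theorem norm_smallDivisorTerm_le {η : ℝ} {φ : ℕ → ℝ} {c z : ℕ → ℂ} {B : ℝ}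
    (hz : ∀ k, ‖z k‖ ≤ ‖c k‖ * B) (J : ℕ) (k : Fin J → ℕ) :
    ‖smallDivisorTerm η φ z J k‖ ≤ ‖smallDivisorTerm η φ c J k‖ * B ^ J := by
  simpa using norm_smallDivisorTerm_le_mul_prod (b := fun _ => B) hz J k

theorem smallDivisorSum_zero (η : ℝ) (φ : ℕ → ℝ) (z : ℕ → ℂ) : smallDivisorSum η φ z 0 = 1 := by
  rw [smallDivisorSum, tsum_fintype]
  simp [smallDivisorTerm, smallDivisorH]

/-- The recursion for `h` turns into a convolution recursion for the series. -/
theorem tsum_divisor_mul_smallDivisorTerm {η : ℝ} {φ : ℕ → ℝ} {c z : ℕ → ℂ} {J : ℕ}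
    (hne : ∀ k : Fin (J + 1) → ℕ, (∀ i, c (k i) ≠ 0) → η - ∑ i, φ (k i) ≠ 0)
    (hz : ∀ k, c k = 0 → z k = 0)
    (hsum : ∀ j, j ≤ J → Summable fun k => ‖smallDivisorTerm η φ z j k‖)
    (hzs : Summable fun k => ‖z k‖) :
    (Summable fun k : Fin (J + 1) → ℕ =>
      ‖((η - ∑ i, φ (k i) : ℝ) : ℂ) * smallDivisorTerm η φ z (J + 1) k‖) ∧
    ∑' k : Fin (J + 1) → ℕ, ((η - ∑ i, φ (k i) : ℝ) : ℂ) * smallDivisorTerm η φ z (J + 1) k =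
      (∑' k, z k) * ∑ j ∈ Finset.range (J + 1),
        smallDivisorSum η φ z j * smallDivisorSum η φ z (J - j) := by
  have hb := fun j : Fin (J + 1) => tsum_mul_blocks (m := j.1) (n := J - j.1) (J := J) (by omega)
    (hsum j.1 (by omega)) (hsum (J - j.1) (by omega)) hzs
  simp only [divisor_mul_smallDivisorTerm hne hz]
  constructor
  · refine Summable.of_nonneg_of_le (fun _ => norm_nonneg _) (fun k => norm_sum_le _ _) ?_
    exact summable_sum fun j _ => (hb j).1
  · rw [Summable.tsum_finsetSum fun j _ => (hb j).1.of_norm, Finset.sum_congr rfl fun j _ => (hb j).2,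
      Finset.sum_range, Finset.mul_sum]
    exact Finset.sum_congr rfl fun j _ => by rw [mul_comm]; rfl

/-! ### Differentiating the series in `x`. -/

/-- The derivative of `smallDivisorTerm` in the direction `w`. -/
noncomputable def smallDivisorTermDeriv (η : ℝ) (φ : ℕ → ℝ) (z w : ℕ → ℂ) (J : ℕ)
    (k : Fin J → ℕ) : ℂ :=
  (∑ i, (∏ j ∈ Finset.univ.erase i, z (k j)) * w (k i)) * (smallDivisorH η J (fun i => φ (k i)) : ℂ)

/-- The derivative of `smallDivisorSum` in the direction `w`. -/
noncomputable def smallDivisorSumDeriv (η : ℝ) (φ : ℕ → ℝ) (z w : ℕ → ℂ) (J : ℕ) : ℂ :=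
  ∑' k, smallDivisorTermDeriv η φ z w J k

/-- Each Leibniz term contains exactly one factor `w`, so the bound is linear in `d`; this is what
makes it summable over the intervals later. -/
theorem norm_smallDivisorTermDeriv_le {η : ℝ} {φ : ℕ → ℝ} {c z w : ℕ → ℂ} {B : ℝ} {d : ℕ → ℝ}
    (hB : 1 ≤ B) (hz : ∀ k, ‖z k‖ ≤ ‖c k‖ * B) (hw : ∀ k, ‖w k‖ ≤ ‖c k‖ * d k) (J : ℕ)
    (k : Fin J → ℕ) :
    ‖smallDivisorTermDeriv η φ z w J k‖ ≤
      ‖smallDivisorTerm η φ c J k‖ * (B ^ J * ∑ i, d (k i)) := by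
  rw [smallDivisorTermDeriv, smallDivisorTerm, norm_mul, norm_mul, norm_prod]
  have key : ∀ i, ‖(∏ j ∈ Finset.univ.erase i, z (k j)) * w (k i)‖ ≤
      (∏ i, ‖c (k i)‖) * (B ^ J * d (k i)) := by
    intro i
    have h0 : 0 ≤ ‖c (k i)‖ * d (k i) := (norm_nonneg _).trans (hw _)
    rw [norm_mul, norm_prod]
    calc (∏ j ∈ Finset.univ.erase i, ‖z (k j)‖) * ‖w (k i)‖
        ≤ (∏ j ∈ Finset.univ.erase i, (‖c (k j)‖ * B)) * (‖c (k i)‖ * d (k i)) := by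
          gcongr with j
          · exact hz _
          · exact hw _
      _ = (∏ j ∈ Finset.univ.erase i, ‖c (k j)‖) * (‖c (k i)‖ * d (k i)) *
            B ^ (Finset.univ.erase i).card := by
          rw [Finset.prod_mul_distrib, Finset.prod_const]
          ring
      _ ≤ (∏ j ∈ Finset.univ.erase i, ‖c (k j)‖) * (‖c (k i)‖ * d (k i)) * B ^ J := by
          gcongr
          exact (Finset.card_le_univ _).trans_eq (Fintype.card_fin J)
      _ = _ := by
          rw [← Finset.mul_prod_erase Finset.univ (fun i => ‖c (k i)‖) (Finset.mem_univ i)]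
          ring
  calc _ ≤ (∑ i, (∏ i, ‖c (k i)‖) * (B ^ J * d (k i))) *
        ‖(smallDivisorH η J (fun i => φ (k i)) : ℂ)‖ := by
        gcongr
        exact (norm_sum_le _ _).trans (Finset.sum_le_sum fun i _ => key i)
    _ = _ := by
        rw [← Finset.mul_sum, ← Finset.mul_sum]
        ring

/-- The oscillating term `c_k e^{-iφ_k x} β_k(x)`. -/
noncomputable def oscTerm (c : ℕ → ℂ) (φ : ℕ → ℝ) (β : ℕ → ℝ → ℂ) (x : ℝ) (k : ℕ) : ℂ :=
  c k * Complex.exp (-Complex.I * (φ k : ℂ) * (x : ℂ)) * β k x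

theorem norm_oscTerm (c : ℕ → ℂ) (φ : ℕ → ℝ) (β : ℕ → ℝ → ℂ) (x : ℝ) (k : ℕ) :
    ‖oscTerm c φ β x k‖ = ‖c k‖ * ‖β k x‖ := by
  have : -Complex.I * (φ k : ℂ) * (x : ℂ) = ((-(φ k * x) : ℝ) : ℂ) * Complex.I := by
    push_cast; ring
  rw [oscTerm, norm_mul, norm_mul, this, Complex.norm_exp_ofReal_mul_I, mul_one]

theorem hasDerivAt_cexp_mul_ofReal (a : ℂ) (x : ℝ) :
    HasDerivAt (fun x : ℝ => Complex.exp (a * (x : ℂ))) (a * Complex.exp (a * (x : ℂ))) x := by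
  have := ((Complex.ofRealCLM.hasDerivAt (x := x)).const_mul a).cexp
  simpa [mul_comm] using this

theorem hasDerivAt_oscTerm {c : ℕ → ℂ} {φ : ℕ → ℝ} {β β' : ℕ → ℝ → ℂ} {x : ℝ} {k : ℕ}
    (h : HasDerivAt (β k) (β' k x) x) :
    HasDerivAt (fun x => oscTerm c φ β x k)
      (-Complex.I * φ k * oscTerm c φ β x k + oscTerm c φ β' x k) x := by
  refine (((hasDerivAt_cexp_mul_ofReal (-Complex.I * φ k) x).const_mul (c k)).mul h).congr_deriv ?_
  simp only [oscTerm]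
  ring

/-- The factor `e^{iηx}` shifts the frequency of the term to `η - ∑ φ`, so differentiation produces
exactly the divisor that the recursion cancels. -/
theorem hasDerivAt_smallDivisorTerm {η : ℝ} {c : ℕ → ℂ} {φ : ℕ → ℝ} {β β' : ℕ → ℝ → ℂ} {x : ℝ}
    (h : ∀ k, HasDerivAt (β k) (β' k x) x) (J : ℕ) (k : Fin J → ℕ) :
    HasDerivAt (fun x : ℝ => Complex.exp (Complex.I * η * x) *
        smallDivisorTerm η φ (oscTerm c φ β x) J k)
      (Complex.exp (Complex.I * η * x) * (Complex.I *
        (((η - ∑ i, φ (k i) : ℝ) : ℂ) * smallDivisorTerm η φ (oscTerm c φ β x) J k) +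
        smallDivisorTermDeriv η φ (oscTerm c φ β x) (oscTerm c φ β' x) J k)) x := by
  have h1 := HasDerivAt.fun_finsetProd (u := Finset.univ)
    (f := fun (i : Fin J) x => oscTerm c φ β x (k i))
    (fun i _ => hasDerivAt_oscTerm (c := c) (φ := φ) (h (k i)))
  refine ((hasDerivAt_cexp_mul_ofReal (Complex.I * η) x).mul
    (h1.mul_const (smallDivisorH η J (fun i => φ (k i)) : ℂ))).congr_deriv ?_
  have h2 : ∑ i : Fin J, (∏ j ∈ Finset.univ.erase i, oscTerm c φ β x (k j)) •
        (-Complex.I * φ (k i) * oscTerm c φ β x (k i) + oscTerm c φ β' x (k i)) =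
      -Complex.I * ((∑ i, φ (k i) : ℝ) : ℂ) * ∏ i, oscTerm c φ β x (k i) +
      ∑ i : Fin J, (∏ j ∈ Finset.univ.erase i, oscTerm c φ β x (k j)) *
        oscTerm c φ β' x (k i) := by
    push_cast
    rw [Finset.mul_sum, Finset.sum_mul, ← Finset.sum_add_distrib]
    refine Finset.sum_congr rfl fun i hi => ?_
    rw [← Finset.mul_prod_erase Finset.univ _ hi, smul_eq_mul]
    ring
  rw [h2]
  simp only [smallDivisorTerm, smallDivisorTermDeriv]
  push_cast
  ring

theorem hasDerivAt_smallDivisorSum {η : ℝ} {c : ℕ → ℂ} {φ : ℕ → ℝ} {β β' : ℕ → ℝ → ℂ} {q : ℕ}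
    {B : ℝ} (hB : 1 ≤ B) (hc : Summable fun k => ‖c k‖)
    (hsmall : ∀ j, 1 ≤ j → j ≤ q → SmallDivisorCondition c φ η j)
    (hβ : ∀ k x, HasDerivAt (β k) (β' k x) x) (hβB : ∀ k x, ‖β k x‖ ≤ B)
    (hβB' : ∀ k x, ‖β' k x‖ ≤ B) {J : ℕ} (hJ : J < q) (x : ℝ) :
    HasDerivAt (fun x => smallDivisorSum η φ (oscTerm c φ β x) (J + 1))
      (-Complex.I * η * smallDivisorSum η φ (oscTerm c φ β x) (J + 1) +
        Complex.I * ((∑' k, oscTerm c φ β x k) * ∑ j ∈ Finset.range (J + 1),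
          smallDivisorSum η φ (oscTerm c φ β x) j *
            smallDivisorSum η φ (oscTerm c φ β x) (J - j)) +
        smallDivisorSumDeriv η φ (oscTerm c φ β x) (oscTerm c φ β' x) (J + 1)) x := by
  have hzB : ∀ x k, ‖oscTerm c φ β x k‖ ≤ ‖c k‖ * B := fun x k => by
    rw [norm_oscTerm]
    gcongr
    exact hβB k x
  have hwB : ∀ x k, ‖oscTerm c φ β' x k‖ ≤ ‖c k‖ * B := fun x k => by
    rw [norm_oscTerm]
    gcongr
    exact hβB' k x
  have hz0 : ∀ x k, c k = 0 → oscTerm c φ β x k = 0 := fun x k h => by simp [oscTerm, h]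
  have hsT : ∀ j, j ≤ q → Summable fun k => ‖smallDivisorTerm η φ c j k‖ :=
    fun j hj => summable_norm_smallDivisorTerm_of_condition hsmall hj
  have hsTx : ∀ x j, j ≤ q → Summable fun k => ‖smallDivisorTerm η φ (oscTerm c φ β x) j k‖ :=
    fun x j hj => Summable.of_nonneg_of_le (fun _ => norm_nonneg _)
      (norm_smallDivisorTerm_le (hzB x) j) ((hsT j hj).mul_right _)
  have hsz : ∀ x, Summable fun k => ‖oscTerm c φ β x k‖ := fun x =>
    Summable.of_nonneg_of_le (fun _ => norm_nonneg _) (hzB x) (hc.mul_right _)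
  have hne := (hsmall (J + 1) (by omega) hJ).1
  -- Taking `z = c` gives a majorant, independent of `x`, for the terms multiplied by their
  -- divisors. No bound on the frequencies is needed.
  have hR := (tsum_divisor_mul_smallDivisorTerm hne (fun k h => h)
    (fun j hj => hsT j (by omega)) hc).1
  have hRx := tsum_divisor_mul_smallDivisorTerm hne (hz0 x) (fun j hj => hsTx x j (by omega)) (hsz x)
  have hD : ∀ x k, ‖smallDivisorTermDeriv η φ (oscTerm c φ β x) (oscTerm c φ β' x) (J + 1) k‖ ≤
      ‖smallDivisorTerm η φ c (J + 1) k‖ * (B ^ (J + 1) * ((J + 1 : ℕ) * B)) := fun x k => by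
    refine (norm_smallDivisorTermDeriv_le hB (hzB x) (hwB x) _ _).trans_eq ?_
    simp
  have hDs : Summable fun k =>
      smallDivisorTermDeriv η φ (oscTerm c φ β x) (oscTerm c φ β' x) (J + 1) k :=
    Summable.of_norm_bounded ((hsT (J + 1) hJ).mul_right _) (hD x)
  have hnormexp : ∀ x : ℝ, ‖Complex.exp (Complex.I * η * x)‖ = 1 := fun x => by
    have : Complex.I * (η : ℂ) * (x : ℂ) = ((η * x : ℝ) : ℂ) * Complex.I := by
      push_cast; ring
    rw [this, Complex.norm_exp_ofReal_mul_I]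
  have hmain := hasDerivAt_tsum (𝕜 := ℝ) (y₀ := x)
    ((hR.mul_right (B ^ (J + 1))).add ((hsT (J + 1) hJ).mul_right _))
    (fun k y => hasDerivAt_smallDivisorTerm (η := η) (c := c) (φ := φ) (fun k => hβ k y) (J + 1) k)
    (fun k y => by
      rw [norm_mul, hnormexp, one_mul]
      refine (norm_add_le _ _).trans (add_le_add ?_ (hD y k))
      rw [norm_mul, Complex.norm_I, one_mul, norm_mul, norm_mul, mul_assoc]
      gcongr
      exact norm_smallDivisorTerm_le (hzB y) _ _)
    ((hsTx x (J + 1) hJ).of_norm.mul_left _) x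
  have hmul := (hasDerivAt_cexp_mul_ofReal (-Complex.I * η) x).mul hmain
  have hexp : ∀ x : ℝ, Complex.exp (-Complex.I * η * x) * Complex.exp (Complex.I * η * x) = 1 :=
    fun x => by
      rw [← Complex.exp_add]
      simp
  have hfun : (fun x : ℝ => smallDivisorSum η φ (oscTerm c φ β x) (J + 1)) =
      (fun x : ℝ => Complex.exp (-Complex.I * η * x)) * fun x : ℝ => ∑' k,
        Complex.exp (Complex.I * η * x) * smallDivisorTerm η φ (oscTerm c φ β x) (J + 1) k := by
    funext y
    rw [Pi.mul_apply, tsum_mul_left, ← mul_assoc, hexp, one_mul]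
    rfl
  rw [hfun]
  refine hmul.congr_deriv ?_
  rw [tsum_mul_left, tsum_mul_left, (hRx.1.of_norm.mul_left _).tsum_add hDs, tsum_mul_left, hRx.2,
    ← smallDivisorSum, ← smallDivisorSumDeriv]
  linear_combination ((-Complex.I * η * smallDivisorSum η φ (oscTerm c φ β x) (J + 1) +
        Complex.I * ((∑' k, oscTerm c φ β x k) * ∑ j ∈ Finset.range (J + 1),
          smallDivisorSum η φ (oscTerm c φ β x) j *
            smallDivisorSum η φ (oscTerm c φ β x) (J - j)) +
        smallDivisorSumDeriv η φ (oscTerm c φ β x) (oscTerm c φ β' x) (J + 1))) * hexp x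

/-! ### Calculus of orders modulo summable sequences. -/

/-- The nonnegative sequence `f` is bounded by a multiple of `S ^ m` up to a summable error. -/
def HasOrder (S : ℕ → ℝ) (m : ℕ) (f : ℕ → ℝ) : Prop :=
  (∀ n, 0 ≤ f n) ∧ ∃ C : ℝ, 0 ≤ C ∧ ∃ d : ℕ → ℝ, Summable d ∧ (∀ n, 0 ≤ d n) ∧
    ∀ n, f n ≤ C * S n ^ m + d n

namespace HasOrder

variable {S f g : ℕ → ℝ} {m l : ℕ} {M : ℝ}

theorem of_summable (hf : ∀ n, 0 ≤ f n) (h : Summable f) : HasOrder S m f :=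
  ⟨hf, 0, le_rfl, f, h, hf, fun n => by simp⟩

theorem const {C : ℝ} (hC : 0 ≤ C) : HasOrder S 0 fun _ => C :=
  ⟨fun _ => hC, C, hC, 0, summable_zero, fun _ => le_rfl, fun n => by simp⟩

theorem add (hf : HasOrder S m f) (hg : HasOrder S m g) : HasOrder S m fun n => f n + g n := by
  obtain ⟨hf0, C, hC, d, hd, hd0, hfd⟩ := hf
  obtain ⟨hg0, C', hC', d', hd', hd0', hgd⟩ := hg
  refine ⟨fun n => add_nonneg (hf0 n) (hg0 n), C + C', add_nonneg hC hC', fun n => d n + d' n,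
    hd.add hd', fun n => add_nonneg (hd0 n) (hd0' n), fun n => ?_⟩
  linarith [hfd n, hgd n]

theorem sum {ι : Type*} {s : Finset ι} {f : ι → ℕ → ℝ} (h : ∀ i ∈ s, HasOrder S m (f i)) :
    HasOrder S m fun n => ∑ i ∈ s, f i n := by
  classical
  induction s using Finset.induction_on with
  | empty => simpa using of_summable (fun _ => le_rfl) summable_zero
  | insert a s ha ih =>
    simp only [Finset.sum_insert ha]
    exact (h a (Finset.mem_insert_self _ _)).add
      (ih fun i hi => h i (Finset.mem_insert_of_mem hi))

theorem const_mul (hf : HasOrder S m f) {K : ℝ} (hK : 0 ≤ K) :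
    HasOrder S m fun n => K * f n := by
  obtain ⟨hf0, C, hC, d, hd, hd0, hfd⟩ := hf
  refine ⟨fun n => mul_nonneg hK (hf0 n), K * C, mul_nonneg hK hC, fun n => K * d n,
    hd.mul_left K, fun n => mul_nonneg hK (hd0 n), fun n => ?_⟩
  linarith [mul_le_mul_of_nonneg_left (hfd n) hK]

theorem le_tsum_of_nonneg {d : ℕ → ℝ} (hd : Summable d) (hd0 : ∀ n, 0 ≤ d n) (n : ℕ) :
    d n ≤ ∑' n, d n :=
  hd.le_tsum n fun i _ => hd0 i

/-- In the expanded product every term except `S ^ (m + l)` contains a summable factor, and its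
other factor is bounded. -/
theorem mul (hf : HasOrder S m f) (hg : HasOrder S l g) (hS : ∀ n, 0 ≤ S n)
    (hSM : ∀ n, S n ≤ M) : HasOrder S (m + l) fun n => f n * g n := by
  obtain ⟨hf0, C, hC, d, hd, hd0, hfd⟩ := hf
  obtain ⟨hg0, C', hC', d', hd', hd0', hgd⟩ := hg
  refine ⟨fun n => mul_nonneg (hf0 n) (hg0 n), C * C', mul_nonneg hC hC',
    fun n => C * M ^ m * d' n + (C' * M ^ l) * d n + (∑' n, d n) * d' n,
    ((hd'.mul_left _).add (hd.mul_left _)).add (hd'.mul_left _), fun n => ?_, fun n => ?_⟩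
  · have hM : 0 ≤ M := (hS n).trans (hSM n)
    have := hd0 n
    have := hd0' n
    have : 0 ≤ ∑' n, d n := tsum_nonneg hd0
    positivity
  · have h1 : S n ^ m ≤ M ^ m := pow_le_pow_left₀ (hS n) (hSM n) m
    have h2 : S n ^ l ≤ M ^ l := pow_le_pow_left₀ (hS n) (hSM n) l
    have h3 := le_tsum_of_nonneg hd hd0 n
    calc f n * g n ≤ (C * S n ^ m + d n) * (C' * S n ^ l + d' n) :=
          mul_le_mul (hfd n) (hgd n) (hg0 n) ((hf0 n).trans (hfd n))
      _ = C * C' * S n ^ (m + l) + (C * S n ^ m * d' n + C' * S n ^ l * d n + d n * d' n) := by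
          ring
      _ ≤ _ := by
          have := hd0 n
          have := hd0' n
          beta_reduce
          gcongr ?_ + (?_ + ?_ + ?_) <;> gcongr

theorem mono_order (hf : HasOrder S m f) (hS : ∀ n, 0 ≤ S n) (hSM : ∀ n, S n ≤ M) (h : l ≤ m) :
    HasOrder S l f := by
  obtain ⟨hf0, C, hC, d, hd, hd0, hfd⟩ := hf
  have hM : 0 ≤ M := (hS 0).trans (hSM 0)
  refine ⟨hf0, C * M ^ (m - l), by positivity, d, hd, hd0, fun n => (hfd n).trans ?_⟩
  rw [mul_assoc]
  gcongr
  calc S n ^ m = S n ^ (m - l) * S n ^ l := by rw [← pow_add]; congr 1; omega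
    _ ≤ M ^ (m - l) * S n ^ l := by
        have := hS n
        gcongr
        exact hSM n

theorem summable (hf : HasOrder S m f) (hS : Summable fun n => S n ^ m) : Summable f := by
  obtain ⟨hf0, C, hC, d, hd, hd0, hfd⟩ := hf
  exact Summable.of_nonneg_of_le hf0 hfd ((hS.mul_left C).add hd)

theorem tendsto_zero (hf : HasOrder S m f) (hm : m ≠ 0)
    (hS : Filter.Tendsto S Filter.atTop (nhds 0)) : Filter.Tendsto f Filter.atTop (nhds 0) := by
  obtain ⟨hf0, C, hC, d, hd, hd0, hfd⟩ := hf
  refine squeeze_zero hf0 hfd ?_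
  simpa [hm] using ((hS.pow m).const_mul C).add hd.tendsto_atTop_zero

end HasOrder

/-! ### Weighted sums of the variations. -/

/-- Interchanging the sums bounds each partial sum over `n` by `K ∑ W i`. -/
theorem summable_tsum_mul_of_sum_range_le {ι : Type*} {W : ι → ℝ} {δ : ι → ℕ → ℝ} {K : ℝ}
    (hW0 : ∀ i, 0 ≤ W i) (hW : Summable W) (hδ0 : ∀ i n, 0 ≤ δ i n)
    (hδ : ∀ i N, ∑ n ∈ Finset.range N, δ i n ≤ K) :
    (∀ n, Summable fun i => W i * δ i n) ∧ Summable fun n => ∑' i, W i * δ i n := by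
  have h1 : ∀ n, Summable fun i => W i * δ i n := fun n => by
    refine Summable.of_nonneg_of_le (fun i => mul_nonneg (hW0 i) (hδ0 i n)) (fun i => ?_)
      (hW.mul_right K)
    refine mul_le_mul_of_nonneg_left ?_ (hW0 i)
    exact (Finset.single_le_sum (f := δ i) (fun n _ => hδ0 i n)
      (Finset.self_mem_range_succ n)).trans (hδ i (n + 1))
  refine ⟨h1, summable_of_sum_range_le (c := (∑' i, W i) * K)
    (fun n => tsum_nonneg fun i => mul_nonneg (hW0 i) (hδ0 i n)) fun N => ?_⟩
  rw [← Summable.tsum_finsetSum fun n _ => h1 n, ← tsum_mul_right]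
  refine Summable.tsum_le_tsum (fun i => ?_) (summable_sum fun n _ => h1 n) (hW.mul_right K)
  rw [← Finset.mul_sum]
  exact mul_le_mul_of_nonneg_left (hδ i N) (hW0 i)

/-- Apart from the pure power of `a`, each term of the expansion contains some `d i`, and the
remaining factors are controlled by `2 * M`. -/
theorem prod_add_le_pow_add_sum {ι : Type*} (s : Finset ι) {a M : ℝ} {d : ι → ℝ} (ha : 0 ≤ a)
    (haM : a ≤ M) (hM : 1 ≤ M) (hd : ∀ i, 0 ≤ d i) (hdM : ∀ i, d i ≤ M) :
    ∏ i ∈ s, (a + d i) ≤ a ^ s.card + (2 * M) ^ s.card * ∑ i ∈ s, d i := by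
  classical
  induction s using Finset.induction_on with
  | empty => simp
  | insert i s hi ih =>
    rw [Finset.prod_insert hi, Finset.sum_insert hi, Finset.card_insert_of_notMem hi]
    have hs : 0 ≤ ∑ i ∈ s, d i := Finset.sum_nonneg fun i _ => hd i
    have h1 : a ^ s.card ≤ (2 * M) ^ (s.card + 1) :=
      calc a ^ s.card ≤ (2 * M) ^ s.card := pow_le_pow_left₀ ha (by linarith) _
        _ ≤ (2 * M) ^ (s.card + 1) := pow_le_pow_right₀ (by linarith) (by omega)
    have h2 : a + d i ≤ 2 * M := by linarith [hdM i]
    have h0 := hd i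
    calc (a + d i) * ∏ i ∈ s, (a + d i)
        ≤ (a + d i) * (a ^ s.card + (2 * M) ^ s.card * ∑ i ∈ s, d i) := by gcongr
      _ = a ^ (s.card + 1) + a ^ s.card * d i +
          (a + d i) * ((2 * M) ^ s.card * ∑ i ∈ s, d i) := by ring
      _ ≤ a ^ (s.card + 1) + (2 * M) ^ (s.card + 1) * d i +
          (2 * M) * ((2 * M) ^ s.card * ∑ i ∈ s, d i) := by gcongr
      _ = _ := by ring

section Weights

variable {S : ℕ → ℝ} {δ : ℕ → ℕ → ℝ} {M : ℝ} {J : ℕ} {W : (Fin J → ℕ) → ℝ}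

theorem summable_tsum_mul_sum (hδ0 : ∀ k n, 0 ≤ δ k n)
    (hδ : ∀ k N, ∑ n ∈ Finset.range N, δ k n ≤ M) (hW0 : ∀ k, 0 ≤ W k) (hW : Summable W) :
    (∀ n, Summable fun k => W k * ∑ i, δ (k i) n) ∧
      Summable fun n => ∑' k, W k * ∑ i, δ (k i) n := by
  refine summable_tsum_mul_of_sum_range_le (K := J * M) hW0 hW
    (fun k n => Finset.sum_nonneg fun i _ => hδ0 _ _) fun k N => ?_
  rw [Finset.sum_comm]
  calc ∑ i, ∑ n ∈ Finset.range N, δ (k i) n ≤ ∑ _i : Fin J, M :=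
        Finset.sum_le_sum fun i _ => hδ _ _
    _ = J * M := by simp

theorem hasOrder_tsum_mul_prod (hS : ∀ n, 0 ≤ S n) (hSM : ∀ n, S n ≤ M) (hM : 1 ≤ M)
    (hδ0 : ∀ k n, 0 ≤ δ k n) (hδ : ∀ k N, ∑ n ∈ Finset.range N, δ k n ≤ M)
    (hW0 : ∀ k, 0 ≤ W k) (hW : Summable W) :
    (∀ n, Summable fun k => W k * ∏ i, (S n + δ (k i) n)) ∧
      HasOrder S J fun n => ∑' k, W k * ∏ i, (S n + δ (k i) n) := by
  obtain ⟨h1, h2⟩ := summable_tsum_mul_sum hδ0 hδ hW0 hW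
  have hδM : ∀ k n, δ k n ≤ M := fun k n =>
    (Finset.single_le_sum (f := δ k) (fun n _ => hδ0 k n) (Finset.self_mem_range_succ n)).trans
      (hδ k (n + 1))
  have h0 : ∀ n k, 0 ≤ W k * ∏ i, (S n + δ (k i) n) := fun n k =>
    mul_nonneg (hW0 k) (Finset.prod_nonneg fun i _ => add_nonneg (hS n) (hδ0 _ _))
  have hle : ∀ n k, W k * ∏ i, (S n + δ (k i) n) ≤
      W k * S n ^ J + (2 * M) ^ J * (W k * ∑ i, δ (k i) n) := fun n k => by
    have := prod_add_le_pow_add_sum (Finset.univ : Finset (Fin J)) (d := fun i => δ (k i) n)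
      (hS n) (hSM n) hM (fun i => hδ0 _ _) (fun i => hδM _ _)
    rw [Finset.card_univ, Fintype.card_fin] at this
    linarith [mul_le_mul_of_nonneg_left this (hW0 k)]
  have hs : ∀ n, Summable fun k => W k * S n ^ J + (2 * M) ^ J * (W k * ∑ i, δ (k i) n) :=
    fun n => (hW.mul_right _).add ((h1 n).mul_left _)
  have hs' := fun n => Summable.of_nonneg_of_le (h0 n) (hle n) (hs n)
  refine ⟨hs', fun n => tsum_nonneg (h0 n), ∑' k, W k, tsum_nonneg hW0,
    fun n => (2 * M) ^ J * ∑' k, W k * ∑ i, δ (k i) n, h2.mul_left _, fun n => ?_, fun n => ?_⟩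
  · exact mul_nonneg (by positivity) (tsum_nonneg fun k =>
      mul_nonneg (hW0 k) (Finset.sum_nonneg fun i _ => hδ0 _ _))
  · refine (Summable.tsum_le_tsum (hle n) (hs' n) (hs n)).trans_eq ?_
    rw [(hW.mul_right _).tsum_add ((h1 n).mul_left _), tsum_mul_right, tsum_mul_left]

end Weights

/-! ### The approximate Riccati solution and its error. -/

theorem sq_sum_range_succ (X : ℕ → ℂ) (q : ℕ) :
    (∑ j ∈ Finset.range (q + 1), X j) ^ 2 =
      ∑ J ∈ Finset.range q, ∑ j ∈ Finset.range (J + 1), X j * X (J - j) +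
        ∑ ij ∈ (Finset.range (q + 1) ×ˢ Finset.range (q + 1)).filter (fun ij => q ≤ ij.1 + ij.2),
          X ij.1 * X ij.2 := by
  rw [sq, Finset.sum_mul_sum, ← Finset.sum_product',
    ← Finset.sum_filter_not_add_sum_filter _ (fun ij : ℕ × ℕ => q ≤ ij.1 + ij.2)]
  congr 1
  rw [Finset.sum_sigma']
  refine (Finset.sum_nbij' (fun a => (a.2, a.1 - a.2)) (fun ij => ⟨ij.1 + ij.2, ij.1⟩)
    ?_ ?_ ?_ ?_ ?_).symm
  · rintro ⟨a, b⟩ h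
    simp only [Finset.mem_sigma, Finset.mem_range] at h
    simp only [Finset.mem_filter, Finset.mem_product, Finset.mem_range]
    omega
  · rintro ⟨a, b⟩ h
    simp only [Finset.mem_filter, Finset.mem_product, Finset.mem_range] at h
    simp only [Finset.mem_sigma, Finset.mem_range]
    omega
  · rintro ⟨a, b⟩ h
    simp only [Finset.mem_sigma, Finset.mem_range] at h
    simp only [Sigma.mk.injEq, heq_eq_eq, and_true]
    omega
  · rintro ⟨a, b⟩ h
    simp
  · rintro ⟨a, b⟩ h
    rfl

/-- The partial sum `∑_{1 ≤ J ≤ q} η^{-J} H_J`, an approximate solution of a Riccati equation. -/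
noncomputable def riccatiSum (η : ℝ) (φ : ℕ → ℝ) (z : ℕ → ℂ) (q : ℕ) : ℂ :=
  ∑ j ∈ Finset.range q, (η : ℂ)⁻¹ ^ (j + 1) * smallDivisorSum η φ z (j + 1)

/-- The error with which `riccatiSum` solves the Riccati equation with potential `v`. -/
noncomputable def riccatiDefect (η : ℝ) (φ : ℕ → ℝ) (z w : ℕ → ℂ) (q : ℕ) (v : ℂ) : ℂ :=
  ∑ j ∈ Finset.range q, (η : ℂ)⁻¹ ^ (j + 1) * smallDivisorSumDeriv η φ z w (j + 1) -
    Complex.I * (∑' k, z k) * (η : ℂ)⁻¹ *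
      ∑ ij ∈ (Finset.range (q + 1) ×ˢ Finset.range (q + 1)).filter (fun ij => q ≤ ij.1 + ij.2),
        ((η : ℂ)⁻¹ ^ ij.1 * smallDivisorSum η φ z ij.1) *
          ((η : ℂ)⁻¹ ^ ij.2 * smallDivisorSum η φ z ij.2) +
    Complex.I * (∑' k, z k - v) * (η : ℂ)⁻¹ * (1 + riccatiSum η φ z q) ^ 2

theorem sum_range_succ_eq_one_add_riccatiSum (η : ℝ) (φ : ℕ → ℝ) (z : ℕ → ℂ) (q : ℕ) :
    ∑ j ∈ Finset.range (q + 1), (η : ℂ)⁻¹ ^ j * smallDivisorSum η φ z j =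
      1 + riccatiSum η φ z q := by
  rw [Finset.sum_range_succ', riccatiSum, smallDivisorSum_zero, add_comm]
  simp

/-- The number `v` is arbitrary, because the last term of the defect accounts for replacing `∑ z_k`
by `v`. The rest is the recursion, with the convolutions collected into a truncated square. -/
theorem hasDerivAt_riccatiSum {η : ℝ} {c : ℕ → ℂ} {φ : ℕ → ℝ} {β β' : ℕ → ℝ → ℂ} {q : ℕ}
    {B : ℝ} (hB : 1 ≤ B) (hc : Summable fun k => ‖c k‖)
    (hsmall : ∀ j, 1 ≤ j → j ≤ q → SmallDivisorCondition c φ η j)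
    (hβ : ∀ k x, HasDerivAt (β k) (β' k x) x) (hβB : ∀ k x, ‖β k x‖ ≤ B)
    (hβB' : ∀ k x, ‖β' k x‖ ≤ B) (x : ℝ) (v : ℂ) :
    HasDerivAt (fun x => riccatiSum η φ (oscTerm c φ β x) q)
      (-Complex.I * η * riccatiSum η φ (oscTerm c φ β x) q +
        Complex.I * v * (η : ℂ)⁻¹ * (1 + riccatiSum η φ (oscTerm c φ β x) q) ^ 2 +
        riccatiDefect η φ (oscTerm c φ β x) (oscTerm c φ β' x) q v) x := by
  have h := HasDerivAt.fun_sum (u := Finset.range q) fun J hJ =>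
    (hasDerivAt_smallDivisorSum hB hc hsmall hβ hβB hβB' (Finset.mem_range.1 hJ) x).const_mul
      ((η : ℂ)⁻¹ ^ (J + 1))
  refine h.congr_deriv ?_
  have hsq := sq_sum_range_succ
    (fun j => (η : ℂ)⁻¹ ^ j * smallDivisorSum η φ (oscTerm c φ β x) j) q
  rw [sum_range_succ_eq_one_add_riccatiSum] at hsq
  have hconv : ∑ J ∈ Finset.range q, (η : ℂ)⁻¹ ^ (J + 1) * ∑ j ∈ Finset.range (J + 1),
        smallDivisorSum η φ (oscTerm c φ β x) j * smallDivisorSum η φ (oscTerm c φ β x) (J - j) =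
      (η : ℂ)⁻¹ * ∑ J ∈ Finset.range q, ∑ j ∈ Finset.range (J + 1),
        ((η : ℂ)⁻¹ ^ j * smallDivisorSum η φ (oscTerm c φ β x) j) *
          ((η : ℂ)⁻¹ ^ (J - j) * smallDivisorSum η φ (oscTerm c φ β x) (J - j)) := by
    rw [Finset.mul_sum]
    refine Finset.sum_congr rfl fun J _ => ?_
    rw [Finset.mul_sum, Finset.mul_sum]
    refine Finset.sum_congr rfl fun j hj => ?_
    have hJ : J + 1 = 1 + (j + (J - j)) := by have := Finset.mem_range.1 hj; omega
    rw [hJ, pow_add, pow_add, pow_one]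
    ring
  have hsplit : ∀ (T : ℂ) (F G H : ℕ → ℂ), ∑ J ∈ Finset.range q, (η : ℂ)⁻¹ ^ (J + 1) *
      (-Complex.I * η * F J + Complex.I * (T * G J) + H J) =
      -Complex.I * η * ∑ J ∈ Finset.range q, (η : ℂ)⁻¹ ^ (J + 1) * F J +
      Complex.I * T * ∑ J ∈ Finset.range q, (η : ℂ)⁻¹ ^ (J + 1) * G J +
      ∑ J ∈ Finset.range q, (η : ℂ)⁻¹ ^ (J + 1) * H J := by
    intro T F G H
    rw [Finset.mul_sum, Finset.mul_sum, ← Finset.sum_add_distrib, ← Finset.sum_add_distrib]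
    exact Finset.sum_congr rfl fun J _ => by ring
  rw [hsplit, hconv, riccatiDefect, ← riccatiSum]
  linear_combination (-(Complex.I * (∑' k, oscTerm c φ β x k) * (η : ℂ)⁻¹)) * hsq

section Bounds

variable {η : ℝ} {φ : ℕ → ℝ} {z w : ℕ → ℂ} {q : ℕ} {A D : ℕ → ℝ}

theorem norm_riccatiSum_le (hη : 0 < η) (hA : ∀ j ≤ q, ‖smallDivisorSum η φ z j‖ ≤ A j) :
    ‖riccatiSum η φ z q‖ ≤ ∑ j ∈ Finset.range q, η⁻¹ ^ (j + 1) * A (j + 1) := by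
  refine (norm_sum_le _ _).trans (Finset.sum_le_sum fun j hj => ?_)
  rw [norm_mul, norm_pow, norm_inv, Complex.norm_real, Real.norm_of_nonneg hη.le]
  gcongr
  exact hA _ (Finset.mem_range.1 hj)

theorem norm_riccatiDefect_le (hη : 0 < η) (hA : ∀ j ≤ q, ‖smallDivisorSum η φ z j‖ ≤ A j)
    (hD : ∀ j ≤ q, ‖smallDivisorSumDeriv η φ z w j‖ ≤ D j) {v : ℂ} {T e : ℝ}
    (hT : ‖∑' k, z k‖ ≤ T) (he : ‖∑' k, z k - v‖ ≤ e) :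
    ‖riccatiDefect η φ z w q v‖ ≤
      ∑ j ∈ Finset.range q, η⁻¹ ^ (j + 1) * D (j + 1) +
      η⁻¹ * ∑ ij ∈ (Finset.range (q + 1) ×ˢ Finset.range (q + 1)).filter
          (fun ij => q ≤ ij.1 + ij.2),
        η⁻¹ ^ ij.1 * η⁻¹ ^ ij.2 * (T * (A ij.1 * A ij.2)) +
      η⁻¹ * ((1 + ‖riccatiSum η φ z q‖) ^ 2 * e) := by
  have hT0 : 0 ≤ T := (norm_nonneg _).trans hT
  have hinv : ‖(η : ℂ)⁻¹‖ = η⁻¹ := by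
    rw [norm_inv, Complex.norm_real, Real.norm_of_nonneg hη.le]
  refine (norm_add_le _ _).trans (add_le_add ((norm_sub_le _ _).trans (add_le_add ?_ ?_)) ?_)
  · refine (norm_sum_le _ _).trans (Finset.sum_le_sum fun j hj => ?_)
    rw [norm_mul, norm_pow, hinv]
    gcongr
    exact hD _ (Finset.mem_range.1 hj)
  · rw [norm_mul, norm_mul, norm_mul, Complex.norm_I, hinv, one_mul, mul_comm ‖∑' k, z k‖ η⁻¹, mul_assoc]
    gcongr
    calc ‖∑' k, z k‖ * ‖_‖ ≤ T * ∑ ij ∈ (Finset.range (q + 1) ×ˢ Finset.range (q + 1)).filter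
          (fun ij => q ≤ ij.1 + ij.2), (η⁻¹ ^ ij.1 * A ij.1) * (η⁻¹ ^ ij.2 * A ij.2) := by
          gcongr
          refine (norm_sum_le _ _).trans (Finset.sum_le_sum fun ij hij => ?_)
          simp only [Finset.mem_filter, Finset.mem_product, Finset.mem_range] at hij
          have h1 := hA ij.1 (by omega)
          have h2 := hA ij.2 (by omega)
          have h3 := (norm_nonneg _).trans h1
          rw [norm_mul, norm_mul, norm_mul, norm_pow, norm_pow, hinv]
          gcongr
      _ = _ := by
          rw [Finset.mul_sum]
          exact Finset.sum_congr rfl fun ij _ => by ring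
  · rw [norm_mul, norm_mul, norm_mul, Complex.norm_I, hinv, one_mul, norm_pow,
      mul_comm ‖∑' k, z k - v‖, mul_assoc, mul_comm ‖∑' k, z k - v‖]
    gcongr
    exact (norm_add_le _ _).trans_eq (by simp)

end Bounds

theorem tendsto_zero_of_summable_pow {S : ℕ → ℝ} {m : ℕ} (hS : ∀ n, 0 ≤ S n)
    (h : Summable fun n => S n ^ m) : Filter.Tendsto S Filter.atTop (nhds 0) := by
  rw [Metric.tendsto_atTop]
  intro ε hε
  obtain ⟨N, hN⟩ := Metric.tendsto_atTop.1 h.tendsto_atTop_zero (ε ^ m) (by positivity)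
  refine ⟨N, fun n hn => ?_⟩
  have := hN n hn
  rw [dist_zero_right, Real.norm_of_nonneg (pow_nonneg (hS n) m)] at this
  rw [dist_zero_right, Real.norm_of_nonneg (hS n)]
  exact lt_of_pow_lt_pow_left₀ m hε.le this

/-- The bounds depend on `n` alone and not on `z`, `w`, `v`, so they hold uniformly for `x` in the
`n`-th interval. -/
theorem exists_summable_riccatiDefect_bound {η : ℝ} (hη : 0 < η) {c : ℕ → ℂ} {φ : ℕ → ℝ} {q : ℕ}
    (hc : Summable fun k => ‖c k‖)
    (hsmall : ∀ j, 1 ≤ j → j ≤ q → SmallDivisorCondition c φ η j)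
    {S : ℕ → ℝ} {δ : ℕ → ℕ → ℝ} {M : ℝ} (hM : 1 ≤ M) (hS : ∀ n, 0 ≤ S n) (hSM : ∀ n, S n ≤ M)
    (hSq : Summable fun n => S n ^ (q + 1)) (hδ0 : ∀ k n, 0 ≤ δ k n)
    (hδ : ∀ k N, ∑ n ∈ Finset.range N, δ k n ≤ M) :
    ∃ g ρ : ℕ → ℝ, Summable g ∧ (∀ n, 0 ≤ g n) ∧ Filter.Tendsto ρ Filter.atTop (nhds 0) ∧
      ∀ n (z w : ℕ → ℂ) (v : ℂ), (∀ k, ‖z k‖ ≤ ‖c k‖ * (S n + δ k n)) →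
        (∀ k, ‖w k‖ ≤ ‖c k‖ * (2 * δ k n)) → ‖∑' k, z k - v‖ ≤ ∑' k, ‖c k‖ * δ k n →
        ‖riccatiSum η φ z q‖ ≤ ρ n ∧ ‖riccatiDefect η φ z w q v‖ ≤ g n := by
  have hη' : 0 ≤ η⁻¹ := (inv_pos.2 hη).le
  have hδM : ∀ k n, δ k n ≤ M := fun k n =>
    (Finset.single_le_sum (f := δ k) (fun n _ => hδ0 k n) (Finset.self_mem_range_succ n)).trans
      (hδ k (n + 1))
  have hsT : ∀ j ≤ q, Summable fun k => ‖smallDivisorTerm η φ c j k‖ :=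
    fun j hj => summable_norm_smallDivisorTerm_of_condition hsmall hj
  obtain ⟨hes, he⟩ := summable_tsum_mul_of_sum_range_le (fun k => norm_nonneg (c k)) hc hδ0 hδ
  have he0 : ∀ n, 0 ≤ ∑' k, ‖c k‖ * δ k n := fun n =>
    tsum_nonneg fun k => mul_nonneg (norm_nonneg _) (hδ0 k n)
  set e : ℕ → ℝ := fun n => ∑' k, ‖c k‖ * δ k n
  set A : ℕ → ℕ → ℝ := fun j n => ∑' k : Fin j → ℕ,
    ‖smallDivisorTerm η φ c j k‖ * ∏ i, (S n + δ (k i) n)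
  set D : ℕ → ℕ → ℝ := fun j n => ∑' k : Fin j → ℕ,
    ‖smallDivisorTerm η φ c j k‖ * ∑ i, δ (k i) n
  set T : ℕ → ℝ := fun n => (∑' k, ‖c k‖) * S n + e n
  have hA := fun j hj => hasOrder_tsum_mul_prod hS hSM hM hδ0 hδ
    (fun k => norm_nonneg (smallDivisorTerm η φ c j k)) (hsT j hj)
  have hD := fun j hj => summable_tsum_mul_sum hδ0 hδ
    (fun k => norm_nonneg (smallDivisorTerm η φ c j k)) (hsT j hj)
  have hD0 : ∀ j n, 0 ≤ D j n := fun j n => tsum_nonneg fun k =>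
    mul_nonneg (norm_nonneg _) (Finset.sum_nonneg fun i _ => hδ0 _ _)
  have hTord : HasOrder S 1 T :=
    ⟨fun n => add_nonneg (mul_nonneg (tsum_nonneg fun k => norm_nonneg _) (hS n)) (he0 n),
      ∑' k, ‖c k‖, tsum_nonneg fun k => norm_nonneg _, e, he, he0, fun n => by
        rw [pow_one]⟩
  set ρ : ℕ → ℝ := fun n => ∑ j ∈ Finset.range q, η⁻¹ ^ (j + 1) * A (j + 1) n
  have hρord : HasOrder S 1 ρ := HasOrder.sum fun j hj =>
    ((hA (j + 1) (Finset.mem_range.1 hj)).2.const_mul (pow_nonneg hη' (j + 1))).mono_order hS hSM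
      (by omega)
  set g : ℕ → ℝ := fun n =>
    ∑ j ∈ Finset.range q, η⁻¹ ^ (j + 1) * ((2 * M) ^ (j + 1) * 2 * D (j + 1) n) +
      η⁻¹ * ∑ ij ∈ (Finset.range (q + 1) ×ˢ Finset.range (q + 1)).filter
          (fun ij => q ≤ ij.1 + ij.2),
        η⁻¹ ^ ij.1 * η⁻¹ ^ ij.2 * (T n * (A ij.1 n * A ij.2 n)) +
      η⁻¹ * ((1 + ρ n) * (1 + ρ n) * e n) with hgdef
  have hρ1 : HasOrder S 0 fun n => 1 + ρ n :=
    (HasOrder.const zero_le_one).add (hρord.mono_order hS hSM (by omega))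
  have hgord : HasOrder S (q + 1) g := by
    refine ((HasOrder.sum fun j hj => ?_).add ((HasOrder.sum fun ij hij => ?_).const_mul hη')).add
      (HasOrder.const_mul ?_ hη')
    · have hj' := Finset.mem_range.1 hj
      exact ((HasOrder.of_summable (hD0 (j + 1)) (hD (j + 1) hj').2).const_mul
        (by positivity)).const_mul (pow_nonneg hη' _)
    -- The factor `T` has order one and the two sums have orders `i` and `j` with `q ≤ i + j`, so
    -- the total order is at least `q + 1`, the summable exponent.
    · simp only [Finset.mem_filter, Finset.mem_product, Finset.mem_range] at hij
      exact ((hTord.mul ((hA ij.1 (by omega)).2.mul (hA ij.2 (by omega)).2 hS hSM)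
        hS hSM).const_mul (by positivity)).mono_order hS hSM (by omega)
    · exact ((hρ1.mul hρ1 hS hSM).mul (HasOrder.of_summable (m := q + 1) he0 he)
        hS hSM).mono_order hS hSM (by omega)
  refine ⟨g, ρ, hgord.summable hSq, hgord.1,
    hρord.tendsto_zero one_ne_zero (tendsto_zero_of_summable_pow hS hSq), ?_⟩
  intro n z w v hz hw hv
  have hSδ0 : ∀ k, 0 ≤ S n + δ k n := fun k => add_nonneg (hS n) (hδ0 k n)
  have hzA : ∀ j ≤ q, ‖smallDivisorSum η φ z j‖ ≤ A j n := fun j hj =>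
    tsum_of_norm_bounded ((hA j hj).1 n).hasSum (norm_smallDivisorTerm_le_mul_prod hz j)
  have hzB : ∀ k, ‖z k‖ ≤ ‖c k‖ * (2 * M) := fun k => (hz k).trans <| by
    gcongr
    linarith [hSM n, hδM k n]
  have hwD : ∀ j ≤ q, ‖smallDivisorSumDeriv η φ z w j‖ ≤ (2 * M) ^ j * 2 * D j n := fun j hj => by
    refine tsum_of_norm_bounded (((hD j hj).1 n).hasSum.mul_left _) fun k => ?_
    refine (norm_smallDivisorTermDeriv_le (by linarith) hzB hw j k).trans_eq ?_
    rw [← Finset.mul_sum]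
    ring
  have hT : ‖∑' k, z k‖ ≤ T n := by
    refine tsum_of_norm_bounded ((hc.hasSum.mul_right (S n)).add (hes n).hasSum) fun k => ?_
    rw [← mul_add]
    exact hz k
  have hr := norm_riccatiSum_le hη hzA
  refine ⟨hr, (norm_riccatiDefect_le hη hzA hwD hT hv).trans ?_⟩
  have := he0 n
  have hρ0 : 0 ≤ 1 + ρ n := hρ1.1 n
  simp only [hgdef, sq]
  gcongr

/-! ### Discretization of the hypotheses on `γ`. -/

section BoundedVariation

variable {γ : ℕ → ℝ → ℂ} {p : ℕ}

/-- If `γ k` exceeded its variation by more than one at some point, its modulus would be at least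
one on the whole half-line, and the integral would diverge. -/
theorem norm_le_of_variation_of_lintegral (hvar : ⨆ k, eVariationOn (γ k) (Ioi 0) < ∞)
    (hLp : ∫⁻ x in Ioi (0 : ℝ), (⨆ k, ‖γ k x‖ₑ) ^ p < ∞) (k : ℕ) {x : ℝ} (hx : 0 < x) :
    ‖γ k x‖ ≤ (⨆ k, eVariationOn (γ k) (Ioi 0)).toReal + 1 := by
  by_contra! hlt
  refine hLp.ne (top_unique ?_)
  calc (∞ : ℝ≥0∞) = ∫⁻ _x in Ioi (0 : ℝ), 1 := by simp
    _ ≤ _ := by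
      refine setLIntegral_mono' measurableSet_Ioi fun y hy => one_le_pow₀ ?_
      refine le_trans ?_ (le_iSup (fun k => ‖γ k y‖ₑ) k)
      have h1 := (eVariationOn.edist_le (γ k) (mem_Ioi.2 hx) hy).trans
        (le_iSup (fun k => eVariationOn (γ k) (Ioi 0)) k)
      have h2 : dist (γ k x) (γ k y) ≤ (⨆ k, eVariationOn (γ k) (Ioi 0)).toReal := by
        rw [← ENNReal.ofReal_le_iff_le_toReal hvar.ne, ← edist_dist]
        exact h1
      have h3 : 1 ≤ ‖γ k y‖ := by
        rw [dist_eq_norm] at h2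
        linarith [norm_sub_norm_le (γ k x) (γ k y)]
      rw [← ofReal_norm, ← ENNReal.ofReal_one]
      exact ENNReal.ofReal_le_ofReal h3

/-- Discretization of uniform bounded variation and the uniform `L^p` condition on the unit
intervals `[n + 1, n + 2]`. -/
theorem exists_unit_interval_bounds (hvar : ⨆ k, eVariationOn (γ k) (Ioi 0) < ∞)
    (hLp : ∫⁻ x in Ioi (0 : ℝ), (⨆ k, ‖γ k x‖ₑ) ^ p < ∞) :
    ∃ (M : ℝ) (S : ℕ → ℝ) (δ : ℕ → ℕ → ℝ), 1 ≤ M ∧ (∀ n, 0 ≤ S n) ∧ (∀ n, S n ≤ M) ∧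
      (Summable fun n => S n ^ p) ∧ (∀ k n, 0 ≤ δ k n) ∧
      (∀ k N, ∑ n ∈ Finset.range N, δ k n ≤ M) ∧
      (∀ k x, 0 < x → ‖γ k x‖ ≤ M) ∧
      (∀ k (n : ℕ), ∀ x ∈ Icc (n + 1 : ℝ) (n + 2), ‖γ k x‖ ≤ S n + δ k n) ∧
      (∀ k (n : ℕ), ∀ x ∈ Icc (n + 1 : ℝ) (n + 2), ∀ y ∈ Icc (n + 1 : ℝ) (n + 2),
        ‖γ k x - γ k y‖ ≤ δ k n) := by
  set Λ := ⨆ k, eVariationOn (γ k) (Ioi 0) with hΛ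
  set G : ℝ → ℝ≥0∞ := fun x => ⨆ k, ‖γ k x‖ₑ with hG
  -- An infimum is bounded by the integral over a unit interval without measurability of `G`.
  -- Half-open intervals are disjoint, so the integrals add up.
  set s : ℕ → ℝ≥0∞ := fun n => ⨅ y ∈ Ico (n + 1 : ℝ) (n + 2), G y with hs
  have hsub : ∀ n : ℕ, Icc (n + 1 : ℝ) (n + 2) ⊆ Ioi 0 := fun n x hx => by
    have := hx.1
    have : (0 : ℝ) ≤ n := n.cast_nonneg
    rw [mem_Ioi]
    linarith
  have hle : ∀ k (n : ℕ), eVariationOn (γ k) (Icc (n + 1 : ℝ) (n + 2)) ≤ Λ := fun k (n : ℕ) =>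
    (eVariationOn.mono _ (hsub n)).trans (le_iSup (fun k => eVariationOn (γ k) (Ioi 0)) k)
  have hfin : ∀ (k n : ℕ), eVariationOn (γ k) (Icc (n + 1 : ℝ) (n + 2)) ≠ ∞ := fun k n =>
    ((hle k n).trans_lt hvar).ne
  have hbound : ∀ k x, 0 < x → ‖γ k x‖ ≤ Λ.toReal + 1 := fun k x hx =>
    norm_le_of_variation_of_lintegral hvar hLp k hx
  have hmemIco : ∀ n : ℕ, (n + 1 : ℝ) ∈ Ico (n + 1 : ℝ) (n + 2) := fun n => by
    constructor <;> linarith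
  have hsM : ∀ n, s n ≤ ENNReal.ofReal (Λ.toReal + 1) := fun n => by
    refine (iInf₂_le _ (hmemIco n)).trans (iSup_le fun k => ?_)
    rw [← ofReal_norm]
    exact ENNReal.ofReal_le_ofReal (hbound k _ (by positivity))
  have hsfin : ∀ n, s n ≠ ∞ := fun n => ((hsM n).trans_lt ENNReal.ofReal_lt_top).ne
  have hΛ0 : 0 ≤ Λ.toReal := ENNReal.toReal_nonneg
  refine ⟨Λ.toReal + 1, fun n => (s n).toReal,
    fun k n => (eVariationOn (γ k) (Icc (n + 1 : ℝ) (n + 2))).toReal, by linarith,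
    fun n => ENNReal.toReal_nonneg, fun n => ?_, ?_, fun k n => ENNReal.toReal_nonneg,
    fun k N => ?_, hbound, fun k n x hx => ?_, fun k n x hx y hy => ?_⟩
  · exact ENNReal.toReal_le_of_le_ofReal (by linarith) (hsM n)
  · have hpow : ∀ n, s n ^ p ≤ ∫⁻ x in Ico (n + 1 : ℝ) (n + 2), G x ^ p := fun n => by
      calc s n ^ p = ∫⁻ _x in Ico (n + 1 : ℝ) (n + 2), s n ^ p := by
            rw [setLIntegral_const, Real.volume_Ico]
            norm_num
        _ ≤ _ := setLIntegral_mono' measurableSet_Ico fun y hy =>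
            pow_le_pow_left₀ zero_le (iInf₂_le y hy) p
    have hdisj : Pairwise (Function.onFun Disjoint fun n : ℕ => Ico (n + 1 : ℝ) (n + 2)) := by
      have := (show Monotone fun n : ℕ => (n + 1 : ℝ) from fun a b h => by
        simpa using h).pairwise_disjoint_on_Ico_succ
      convert this using 4
      simp only [Order.succ_eq_add_one]
      push_cast
      ring
    have htsum : ∑' n, s n ^ p ≠ ∞ := by
      refine ne_top_of_le_ne_top hLp.ne ((ENNReal.tsum_le_tsum hpow).trans ?_)
      rw [← lintegral_iUnion (fun n => measurableSet_Ico) hdisj]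
      exact lintegral_mono_set (iUnion_subset fun n =>
        Ico_subset_Icc_self.trans (hsub n))
    simpa using ENNReal.summable_toReal htsum
  · rw [← ENNReal.toReal_sum fun n _ => hfin k n]
    have h1 := eVariationOn.sum' (γ k) (I := fun n : ℕ => (n + 1 : ℝ))
      (fun a b h => by simpa using h) (n := N)
    have h2 : ∑ n ∈ Finset.range N, eVariationOn (γ k) (Icc (n + 1 : ℝ) (n + 2)) ≤ Λ := by
      have h3 : ∀ n : ℕ, ((n + 1 : ℕ) + 1 : ℝ) = n + 2 := fun n => by push_cast; ring
      simp only [h3] at h1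
      rw [h1]
      refine (eVariationOn.mono _ fun x hx => ?_).trans
        (le_iSup (fun k => eVariationOn (γ k) (Ioi 0)) k)
      have := hx.1
      push_cast at this
      rw [mem_Ioi]
      linarith
    linarith [ENNReal.toReal_mono hvar.ne h2]
  · have h1 : ‖γ k x‖ₑ ≤ s n + eVariationOn (γ k) (Icc (n + 1 : ℝ) (n + 2)) := by
      rw [← tsub_le_iff_right]
      refine le_iInf₂ fun y hy => ?_
      rw [tsub_le_iff_right]
      have h2 := eVariationOn.edist_le (γ k) hx (Ico_subset_Icc_self hy)
      calc ‖γ k x‖ₑ ≤ ‖γ k y‖ₑ + edist (γ k x) (γ k y) := by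
            rw [edist_comm, ← edist_zero_right, ← edist_zero_right, edist_comm (γ k x),
              edist_comm (γ k y)]
            exact edist_triangle _ _ _
        _ ≤ _ := add_le_add (le_iSup (fun k => ‖γ k y‖ₑ) k) h2
    have h3 := ENNReal.toReal_mono (ENNReal.add_ne_top.2 ⟨hsfin n, hfin k n⟩) h1
    rwa [ENNReal.toReal_add (hsfin n) (hfin k n), toReal_enorm] at h3
  · rw [← dist_eq_norm, ← ENNReal.ofReal_le_iff_le_toReal (hfin k n), ← edist_dist]
    exact eVariationOn.edist_le (γ k) hx hy

end BoundedVariation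

/-! ### Absolute continuity and Gronwall's inequality. -/

namespace AbsolutelyContinuousOnInterval

variable {E F : Type*} [PseudoMetricSpace E] [PseudoMetricSpace F]

theorem of_dist_le_mul {f : ℝ → E} {g : ℝ → F} {a b C : ℝ}
    (hg : AbsolutelyContinuousOnInterval g a b)
    (h : ∀ x ∈ uIcc a b, ∀ y ∈ uIcc a b, dist (f x) (f y) ≤ C * dist (g x) (g y)) :
    AbsolutelyContinuousOnInterval f a b := by
  refine squeeze_zero' (Filter.Eventually.of_forall fun _ => Finset.sum_nonneg fun _ _ =>
    dist_nonneg) ?_ (by simpa using Filter.Tendsto.const_mul C hg)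
  refine Filter.eventually_inf_principal.2 (Filter.Eventually.of_forall fun I hI => ?_)
  rw [Finset.mul_sum]
  exact Finset.sum_le_sum fun i hi => h _ (hI.1 i hi).1 _ (hI.1 i hi).2

theorem norm_comp {E : Type*} [SeminormedAddCommGroup E] {f : ℝ → E} {a b : ℝ}
    (hf : AbsolutelyContinuousOnInterval f a b) :
    AbsolutelyContinuousOnInterval (fun x => ‖f x‖) a b :=
  hf.of_dist_le_mul (C := 1) fun x _ y _ => by
    rw [one_mul]
    exact (dist_norm_norm_le (f x) (f y)).trans_eq (dist_eq_norm (f x) (f y)).symm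

theorem le_of_deriv_nonpos {f : ℝ → ℝ} {a b : ℝ} (hab : a ≤ b)
    (hf : AbsolutelyContinuousOnInterval f a b)
    (h : ∀ᵐ x ∂volume.restrict (Icc a b), deriv f x ≤ 0) : f b ≤ f a := by
  have h1 := intervalIntegral.integral_mono_ae_restrict hab hf.intervalIntegrable_deriv
    (intervalIntegrable_const (c := (0 : ℝ))) h
  rw [hf.integral_deriv_eq_sub] at h1
  simp only [intervalIntegral.integral_zero] at h1
  linarith

/-- Gronwall's inequality for absolutely continuous functions. -/
theorem le_mul_exp {f f' : ℝ → ℝ} {a b K : ℝ} (hab : a ≤ b)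
    (hf : AbsolutelyContinuousOnInterval f a b)
    (h : ∀ᵐ x ∂volume.restrict (Icc a b), HasDerivAt f (f' x) x ∧ f' x ≤ K * f x) :
    f b ≤ f a * Real.exp (K * (b - a)) := by
  have hexp : AbsolutelyContinuousOnInterval (fun x => Real.exp (-K * x)) a b :=
    ContDiffOn.absolutelyContinuousOnInterval (by fun_prop)
  have h1 := (hf.fun_mul hexp).le_of_deriv_nonpos hab <| by
    filter_upwards [h] with x hx
    have h2 : HasDerivAt (fun x => Real.exp (-K * x)) (Real.exp (-K * x) * (-K * 1)) x :=
      ((hasDerivAt_id x).const_mul (-K)).exp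
    rw [(hx.1.fun_mul h2).deriv]
    have := mul_nonneg (sub_nonneg.2 hx.2) (Real.exp_pos (-K * x)).le
    linarith
  calc f b = f b * Real.exp (-K * b) * Real.exp (K * b) := by
        rw [mul_assoc, ← Real.exp_add]; simp
    _ ≤ f a * Real.exp (-K * a) * Real.exp (K * b) := by gcongr
    _ = _ := by
        rw [mul_assoc, ← Real.exp_add]
        ring_nf

theorem le_mul_exp_backward {f f' : ℝ → ℝ} {a b K : ℝ} (hab : a ≤ b)
    (hf : AbsolutelyContinuousOnInterval f a b)
    (h : ∀ᵐ x ∂volume.restrict (Icc a b), HasDerivAt f (f' x) x ∧ -(K * f x) ≤ f' x) :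
    f a ≤ f b * Real.exp (K * (b - a)) := by
  have h1 := hf.fun_neg.le_mul_exp (f' := fun x => -f' x) (K := -K) hab <| by
    filter_upwards [h] with x hx
    exact ⟨hx.1.neg, by linarith [hx.2]⟩
  calc f a = f a * Real.exp (-K * (b - a)) * Real.exp (K * (b - a)) := by
        rw [mul_assoc, ← Real.exp_add]; simp
    _ ≤ f b * Real.exp (K * (b - a)) := by
        gcongr
        linarith

end AbsolutelyContinuousOnInterval


/-! ### The energy and its growth. -/

/-- The energy of the pair `(a, b)` relative to the reflection coefficient `r`. -/
noncomputable def reflectionEnergy (a b r : ℂ) : ℝ :=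
  (‖b + r * a‖ ^ 2 + ‖a + conj r * b‖ ^ 2) * (1 - ‖r‖ ^ 2)⁻¹

/-- For `|r| ≤ 1/2` the map from `(a, b)` to the two combinations is invertible with bounded
inverse, so the energy controls both amplitudes. -/
theorem sq_add_sq_le_reflectionEnergy {a b r : ℂ} (hr : ‖r‖ ≤ 1 / 2) :
    ‖a‖ ^ 2 + ‖b‖ ^ 2 ≤ 4 * reflectionEnergy a b r := by
  have h1 : ‖b‖ ≤ ‖b + r * a‖ + ‖a‖ / 2 := by
    calc ‖b‖ = ‖(b + r * a) - r * a‖ := by ring_nf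
      _ ≤ ‖b + r * a‖ + ‖r‖ * ‖a‖ := (norm_sub_le _ _).trans_eq (by rw [norm_mul])
      _ ≤ _ := by nlinarith [norm_nonneg a]
  have h2 : ‖a‖ ≤ ‖a + conj r * b‖ + ‖b‖ / 2 := by
    calc ‖a‖ = ‖(a + conj r * b) - conj r * b‖ := by ring_nf
      _ ≤ ‖a + conj r * b‖ + ‖r‖ * ‖b‖ :=
        (norm_sub_le _ _).trans_eq (by rw [norm_mul, RCLike.norm_conj])
      _ ≤ _ := by nlinarith [norm_nonneg b]
  have hw : 3 / 4 ≤ 1 - ‖r‖ ^ 2 := by nlinarith [norm_nonneg r]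
  have hw1 : 1 ≤ (1 - ‖r‖ ^ 2)⁻¹ := (one_le_inv₀ (by linarith)).2 (by nlinarith [norm_nonneg r])
  have h3 : ‖b + r * a‖ ^ 2 + ‖a + conj r * b‖ ^ 2 ≤ reflectionEnergy a b r :=
    le_mul_of_one_le_right (by positivity) hw1
  have h4 := norm_nonneg a
  have h5 := norm_nonneg b
  nlinarith [mul_self_nonneg (‖a‖ - ‖b‖), norm_nonneg (b + r * a), norm_nonneg (a + conj r * b),
    mul_self_nonneg (‖b + r * a‖ - ‖b‖ / 2), mul_self_nonneg (‖a + conj r * b‖ - ‖a‖ / 2),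
    mul_self_nonneg (‖b + r * a‖ - ‖a‖ / 2), mul_self_nonneg (‖a + conj r * b‖ - ‖b‖ / 2)]

/-- Along a solution, the energy relative to an approximate solution of the Riccati equation
grows at most at the rate of the error. -/
theorem energy_derivative_le {η v g : ℝ} (hη : 0 < η) {s t r ε a b a' b' r' : ℂ}
    (ha : a = t + Complex.I * (η / 2) * s) (hb : b = t - Complex.I * (η / 2) * s)
    (ha' : a' = (v - η ^ 2 / 4) * s + Complex.I * (η / 2) * t)
    (hb' : b' = (v - η ^ 2 / 4) * s - Complex.I * (η / 2) * t)
    (hr' : r' = -Complex.I * η * r + Complex.I * v * (η : ℂ)⁻¹ * (1 + r) ^ 2 + ε)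
    (hr : ‖r‖ ≤ 1 / 2) (hε : ‖ε‖ ≤ g) :
    (2 * inner ℝ (b + r * a) (b' + (r' * a + r * a')) +
        2 * inner ℝ (a + conj r * b) (a' + (conj r' * b + conj r * b'))) * (1 - ‖r‖ ^ 2)⁻¹ +
      (‖b + r * a‖ ^ 2 + ‖a + conj r * b‖ ^ 2) *
        (-(-(2 * inner ℝ r r')) / (1 - ‖r‖ ^ 2) ^ 2) ≤ 6 * g * reflectionEnergy a b r := by
  have hη0 : (η : ℂ) ≠ 0 := by exact_mod_cast hη.ne'
  have hηinv : (η : ℂ) * (η : ℂ)⁻¹ = 1 := mul_inv_cancel₀ hη0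
  have ha2 : a' = Complex.I * (η / 2) * a - Complex.I * v * (η : ℂ)⁻¹ * (a - b) := by
    rw [ha', ha, hb]
    linear_combination (-(η ^ 2 / 4) * s + v * s) * Complex.I_sq + v * s * Complex.I ^ 2 * hηinv
  have hb2 : b' = -Complex.I * (η / 2) * b - Complex.I * v * (η : ℂ)⁻¹ * (a - b) := by
    rw [hb', ha, hb]
    linear_combination (-(η ^ 2 / 4) * s + v * s) * Complex.I_sq + v * s * Complex.I ^ 2 * hηinv
  have hcr' : conj r' = Complex.I * η * conj r -
      Complex.I * v * (η : ℂ)⁻¹ * (1 + conj r) ^ 2 + conj ε := by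
    rw [hr']
    simp only [map_add, map_mul, map_neg, map_pow, map_one, map_inv₀, Complex.conj_I,
      Complex.conj_ofReal]
    ring
  set D := b + r * a with hD
  set D' := a + conj r * b with hD'
  -- By the Riccati equation, the combination obeys a scalar equation with `ε * a` as its only
  -- source.
  have e1 : b' + (r' * a + r * a') =
      (-Complex.I * (η / 2) + Complex.I * v * (η : ℂ)⁻¹ * (1 + r)) * D + ε * a := by
    rw [hD, hr', ha2, hb2]
    ring
  have e2 : a' + (conj r' * b + conj r * b') =
      (Complex.I * (η / 2) - Complex.I * v * (η : ℂ)⁻¹ * (1 + conj r)) * D' + conj ε * b := by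
    rw [hD', hcr', ha2, hb2]
    ring
  have i1 : inner ℝ D (b' + (r' * a + r * a')) =
      -(v * η⁻¹ * r.im) * ‖D‖ ^ 2 + inner ℝ D (ε * a) := by
    rw [e1, inner_add_right]
    congr 1
    rw [Complex.inner, ← Complex.normSq_eq_norm_sq, Complex.normSq_apply, ← Complex.ofReal_inv]
    simp
    ring
  have i2 : inner ℝ D' (a' + (conj r' * b + conj r * b')) =
      -(v * η⁻¹ * r.im) * ‖D'‖ ^ 2 + inner ℝ D' (conj ε * b) := by
    rw [e2, inner_add_right]
    congr 1
    rw [Complex.inner, ← Complex.normSq_eq_norm_sq, Complex.normSq_apply, ← Complex.ofReal_inv]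
    simp
    ring
  have i3 : inner ℝ r r' = v * η⁻¹ * r.im * (1 - ‖r‖ ^ 2) + inner ℝ r ε := by
    rw [hr', inner_add_right]
    congr 1
    rw [Complex.inner, ← Complex.normSq_eq_norm_sq, Complex.normSq_apply, ← Complex.ofReal_inv]
    simp [sq]
    ring
  have hg0 : 0 ≤ g := (norm_nonneg _).trans hε
  have hw : 3 / 4 ≤ 1 - ‖r‖ ^ 2 := by nlinarith [norm_nonneg r]
  have hwpos : 0 < 1 - ‖r‖ ^ 2 := by linarith
  have j1 : inner ℝ D (ε * a) ≤ ‖D‖ * (g * ‖a‖) := by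
    refine (real_inner_le_norm _ _).trans ?_
    rw [norm_mul]
    gcongr
  have j2 : inner ℝ D' (conj ε * b) ≤ ‖D'‖ * (g * ‖b‖) := by
    refine (real_inner_le_norm _ _).trans ?_
    rw [norm_mul, RCLike.norm_conj]
    gcongr
  have j3 : inner ℝ r ε ≤ g / 2 := by
    refine (real_inner_le_norm _ _).trans ?_
    nlinarith [norm_nonneg r, norm_nonneg ε]
  have n1 : ‖b‖ ≤ ‖D‖ + ‖a‖ / 2 := by
    calc ‖b‖ = ‖D - r * a‖ := by rw [hD]; ring_nf
      _ ≤ ‖D‖ + ‖r‖ * ‖a‖ := (norm_sub_le _ _).trans_eq (by rw [norm_mul])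
      _ ≤ _ := by nlinarith [norm_nonneg a]
  have n2 : ‖a‖ ≤ ‖D'‖ + ‖b‖ / 2 := by
    calc ‖a‖ = ‖D' - conj r * b‖ := by rw [hD']; ring_nf
      _ ≤ ‖D'‖ + ‖r‖ * ‖b‖ := (norm_sub_le _ _).trans_eq (by rw [norm_mul, RCLike.norm_conj])
      _ ≤ _ := by nlinarith [norm_nonneg b]
  have hQ : ‖D‖ * ‖a‖ + ‖D'‖ * ‖b‖ ≤ 2 * (‖D‖ ^ 2 + ‖D'‖ ^ 2) := by
    have m1 : ‖a‖ ≤ 4 / 3 * ‖D'‖ + 2 / 3 * ‖D‖ := by linarith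
    have m2 : ‖b‖ ≤ 4 / 3 * ‖D‖ + 2 / 3 * ‖D'‖ := by linarith
    have h1 := mul_le_mul_of_nonneg_left m1 (norm_nonneg D)
    have h2 := mul_le_mul_of_nonneg_left m2 (norm_nonneg D')
    linarith [sq_nonneg (‖D‖ - ‖D'‖)]
  set w := 1 - ‖r‖ ^ 2 with hwdef
  set Q := ‖D‖ ^ 2 + ‖D'‖ ^ 2 with hQdef
  have hQ0 : 0 ≤ Q := by positivity
  have hX : inner ℝ D (ε * a) + inner ℝ D' (conj ε * b) ≤ 2 * g * Q := by
    linarith [mul_le_mul_of_nonneg_left hQ hg0]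
  -- The contributions of `v * η⁻¹ * r.im` from the numerator and from the weight cancel, leaving
  -- only terms with `ε`.
  have hfinal : (2 * inner ℝ D (b' + (r' * a + r * a')) +
        2 * inner ℝ D' (a' + (conj r' * b + conj r * b'))) * w⁻¹ +
      Q * (-(-(2 * inner ℝ r r')) / w ^ 2) =
      2 * (inner ℝ D (ε * a) + inner ℝ D' (conj ε * b)) * w⁻¹ +
        2 * Q * inner ℝ r ε * w⁻¹ * w⁻¹ := by
    rw [i1, i2, i3]
    field_simp
    ring
  have hwinv : w⁻¹ ≤ 4 / 3 := by
    rw [inv_le_comm₀ hwpos (by norm_num)]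
    linarith
  have hwinv0 : 0 ≤ w⁻¹ := inv_nonneg.2 hwpos.le
  rw [hfinal]
  calc 2 * (inner ℝ D (ε * a) + inner ℝ D' (conj ε * b)) * w⁻¹ +
        2 * Q * inner ℝ r ε * w⁻¹ * w⁻¹
      ≤ 2 * (2 * g * Q) * w⁻¹ + 2 * Q * (g / 2) * w⁻¹ * (4 / 3) := by gcongr
    -- The constant on the left is `4 + 4/3`, rounded up to `6`.
    _ ≤ 6 * g * (Q * w⁻¹) := by
        have : 0 ≤ g * (Q * w⁻¹) := by positivity
        linarith
    _ = _ := by rw [reflectionEnergy, ← hD, ← hD']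

/-! ### Estimates for solutions. -/

namespace IsSchrodingerSolution

/-- The amplitudes `u' ± (iη/2) u` of a function `u`. -/
noncomputable def amplitude (η : ℝ) (u : ℝ → ℂ) (x : ℝ) : ℂ :=
  deriv u x + Complex.I * (η / 2) * u x

variable {V : ℝ → ℝ} {E η : ℝ} {u : ℝ → ℂ}

theorem ae_hasDerivAt (hu : IsSchrodingerSolution V E u) {a b : ℝ} (ha : 0 < a) :
    ∀ᵐ x ∂volume.restrict (Icc a b), HasDerivAt (deriv u) ((V x - E) * u x) x := by
  have hsub : Icc a b ⊆ Ioi (0 : ℝ) := fun x hx => ha.trans_le hx.1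
  filter_upwards [ae_restrict_of_ae_restrict_of_subset hsub hu.equation] with x hx
  refine hx.1.hasDerivAt.congr_deriv ?_
  linear_combination -hx.2

theorem absolutelyContinuousOnInterval_amplitude (hu : IsSchrodingerSolution V E u) (η : ℝ)
    {a b : ℝ} (ha : 0 < a) (hab : a ≤ b) :
    AbsolutelyContinuousOnInterval (amplitude η u) a b :=
  (hu.locallyAC_deriv a b ha hab).fun_add
    ((hu.locallyAC a b ha hab).const_smul (Complex.I * (η / 2)))

theorem reflectionEnergy_le (hη : 0 < η) (hu : IsSchrodingerSolution V (η ^ 2 / 4) u) {a b : ℝ}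
    (ha : 0 < a) (hab : a ≤ b) {r ε : ℝ → ℂ} {g K : ℝ}
    (hr' : ∀ x ∈ Icc a b, HasDerivAt r (-Complex.I * η * r x +
      Complex.I * V x * (η : ℂ)⁻¹ * (1 + r x) ^ 2 + ε x) x)
    (hr : ∀ x ∈ Icc a b, ‖r x‖ ≤ 1 / 2) (hε : ∀ x ∈ Icc a b, ‖ε x‖ ≤ g)
    (hV : ∀ x ∈ Icc a b, |V x| ≤ K) :
    reflectionEnergy (amplitude η u b) (amplitude (-η) u b) (r b) ≤
      reflectionEnergy (amplitude η u a) (amplitude (-η) u a) (r a) *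
        Real.exp (6 * g * (b - a)) := by
  have hK : 0 ≤ K := (abs_nonneg _).trans (hV a (left_mem_Icc.2 hab))
  -- The derivative of `r` is bounded, so `r` is Lipschitz. The bound `K` on `V` serves only this
  -- purpose and does not enter the growth rate.
  have hrAC : AbsolutelyContinuousOnInterval r a b := by
    have hid : AbsolutelyContinuousOnInterval (fun x : ℝ => x) a b :=
      ContDiffOn.absolutelyContinuousOnInterval contDiffOn_id
    refine hid.of_dist_le_mul (C := η * (1 / 2) + K * η⁻¹ * (1 + 1 / 2) ^ 2 + g)
      fun x hx y hy => ?_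
    rw [uIcc_of_le hab] at hx hy
    rw [dist_eq_norm, dist_eq_norm]
    refine (convex_Icc a b).norm_image_sub_le_of_norm_hasDerivWithin_le
      (fun x hx => (hr' x hx).hasDerivWithinAt) (fun x hx => ?_) hy hx
    refine (norm_add_le _ _).trans (add_le_add ((norm_add_le _ _).trans (add_le_add ?_ ?_))
      (hε x hx))
    · rw [norm_mul, norm_mul, norm_neg, Complex.norm_I, one_mul, Complex.norm_real,
        Real.norm_of_nonneg hη.le]
      gcongr
      exact hr x hx
    · rw [norm_mul, norm_mul, norm_mul, norm_pow, Complex.norm_I, one_mul, Complex.norm_real,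
        norm_inv, Complex.norm_real, Real.norm_of_nonneg hη.le, Real.norm_eq_abs]
      gcongr
      · exact hV x hx
      · refine (norm_add_le _ _).trans ?_
        rw [norm_one]
        gcongr
        exact hr x hx
  have hcrAC : AbsolutelyContinuousOnInterval (fun x => conj (r x)) a b :=
    hrAC.of_dist_le_mul (C := 1) fun x _ y _ => by
      rw [one_mul, dist_eq_norm, dist_eq_norm, ← map_sub, RCLike.norm_conj]
  have hA := hu.absolutelyContinuousOnInterval_amplitude η ha hab
  have hB := hu.absolutelyContinuousOnInterval_amplitude (-η) ha hab
  have hD := (hB.fun_add (hrAC.fun_smul hA)).norm_comp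
  have hD' := (hA.fun_add (hcrAC.fun_smul hB)).norm_comp
  have hw : ∀ x ∈ Icc a b, 3 / 4 ≤ 1 - ‖r x‖ ^ 2 := fun x hx => by
    nlinarith [hr x hx, norm_nonneg (r x)]
  have hinv : AbsolutelyContinuousOnInterval (fun x => (1 - ‖r x‖ ^ 2)⁻¹) a b := by
    -- Both weights are at least `3/4`, so inversion has Lipschitz constant `(4/3)² = 16/9`.
    refine (hrAC.norm_comp.fun_mul hrAC.norm_comp).of_dist_le_mul (C := 16 / 9) fun x hx y hy => ?_
    rw [uIcc_of_le hab] at hx hy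
    have hwx := hw x hx
    have hwy := hw y hy
    rw [Real.dist_eq, Real.dist_eq, inv_sub_inv (by linarith) (by linarith), abs_div,
      div_le_iff₀ (abs_pos.2 (by nlinarith)), abs_of_nonneg (a := _ * _) (by nlinarith)]
    have h1 : 9 / 16 ≤ (1 - ‖r x‖ ^ 2) * (1 - ‖r y‖ ^ 2) := by nlinarith
    have h2 : |1 - ‖r y‖ ^ 2 - (1 - ‖r x‖ ^ 2)| = |‖r x‖ * ‖r x‖ - ‖r y‖ * ‖r y‖| := by
      congr 1
      ring
    rw [h2]
    nlinarith [abs_nonneg (‖r x‖ * ‖r x‖ - ‖r y‖ * ‖r y‖)]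
  have hE : AbsolutelyContinuousOnInterval
      (fun x => reflectionEnergy (amplitude η u x) (amplitude (-η) u x) (r x)) a b := by
    have h := ((hD.fun_mul hD).fun_add (hD'.fun_mul hD')).fun_mul hinv
    simp only [smul_eq_mul, ← sq] at h
    exact h
  have hae : ∀ᵐ x ∂volume.restrict (Icc a b), x ∈ Icc a b := ae_restrict_mem measurableSet_Icc
  refine hE.le_mul_exp hab (f' := fun x => deriv (fun x =>
    reflectionEnergy (amplitude η u x) (amplitude (-η) u x) (r x)) x) ?_
  filter_upwards [hu.ae_hasDerivAt ha (b := b), hae] with x hx hxI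
  have hux : HasDerivAt u (deriv u x) x := (hu.differentiableAt x (ha.trans_le hxI.1)).hasDerivAt
  have dA : HasDerivAt (amplitude η u)
      ((V x - η ^ 2 / 4) * u x + Complex.I * (η / 2) * deriv u x) x := by
    refine (hx.add (hux.const_mul (Complex.I * (η / 2)))).congr_deriv ?_
    push_cast
    ring
  have dB : HasDerivAt (amplitude (-η) u)
      ((V x - η ^ 2 / 4) * u x - Complex.I * (η / 2) * deriv u x) x := by
    refine (hx.add (hux.const_mul (Complex.I * ((-η : ℝ) / 2)))).congr_deriv ?_
    push_cast
    ring
  have dr := hr' x hxI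
  have dcr : HasDerivAt (fun x => conj (r x)) (conj (-Complex.I * η * r x +
      Complex.I * V x * (η : ℂ)⁻¹ * (1 + r x) ^ 2 + ε x)) x := dr.star
  have hwx : 1 - ‖r x‖ ^ 2 ≠ 0 := by linarith [hw x hxI]
  have dE := (((dB.add (dr.mul dA)).norm_sq).add ((dA.add (dcr.mul dB)).norm_sq)).mul
    ((dr.norm_sq.const_sub 1).inv hwx)
  have hle := energy_derivative_le (v := V x) hη (s := u x) (t := deriv u x)
    (a := amplitude η u x) (b := amplitude (-η) u x) rfl
    (by simp only [amplitude]; push_cast; ring) rfl rfl rfl (hr x hxI) (hε x hxI)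
  have dE' : HasDerivAt
      (fun x => reflectionEnergy (amplitude η u x) (amplitude (-η) u x) (r x)) _ x := dE
  rw [dE'.deriv]
  exact ⟨dE', hle⟩

/-- With `V` bounded up to zero, backward Gronwall for `|u|² + |u'|²` starting at `a` gives a
constant that does not degenerate as `x` tends to zero. -/
theorem exists_bound_near_zero (hu : IsSchrodingerSolution V E u) {a K : ℝ} (ha : 0 < a)
    (hV : ∀ x ∈ Ioc 0 a, |V x| ≤ K) :
    ∃ C : ℝ, ∀ x ∈ Ioc 0 a, ‖u x‖ ≤ C := by
  have hK : 0 ≤ K := (abs_nonneg _).trans (hV a ⟨ha, le_rfl⟩)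
  set L := K + |E| + 1 with hL
  have hL0 : 0 ≤ L := by positivity
  set N : ℝ → ℝ := fun x => ‖u x‖ ^ 2 + ‖deriv u x‖ ^ 2 with hN
  refine ⟨√(N a * Real.exp (L * a)), fun x hx => Real.le_sqrt_of_sq_le ?_⟩
  have h1 := (hu.locallyAC x a hx.1 hx.2).norm_comp
  have h2 := (hu.locallyAC_deriv x a hx.1 hx.2).norm_comp
  have hNAC : AbsolutelyContinuousOnInterval N x a := by
    have h := (h1.fun_mul h1).fun_add (h2.fun_mul h2)
    simpa only [← sq] using h
  have hae : ∀ᵐ y ∂volume.restrict (Icc x a), y ∈ Icc x a := ae_restrict_mem measurableSet_Icc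
  have hback : N x ≤ N a * Real.exp (L * (a - x)) := by
    refine hNAC.le_mul_exp_backward hx.2 (f' := fun y =>
      2 * inner ℝ (u y) (deriv u y) + 2 * inner ℝ (deriv u y) ((V y - E) * u y)) ?_
    filter_upwards [hu.ae_hasDerivAt hx.1 (b := a), hae] with y hy hyI
    have hypos : 0 < y := hx.1.trans_le hyI.1
    refine ⟨((hu.differentiableAt y hypos).hasDerivAt.norm_sq).add hy.norm_sq, ?_⟩
    have i1 := neg_le_of_abs_le (abs_real_inner_le_norm (u y) (deriv u y))
    have i2 := neg_le_of_abs_le (abs_real_inner_le_norm (deriv u y) ((V y - E) * u y))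
    have i3 : ‖(V y - E : ℂ)‖ ≤ K + |E| := by
      rw [← Complex.ofReal_sub, Complex.norm_real, Real.norm_eq_abs]
      exact (abs_sub _ _).trans (by gcongr; exact hV y ⟨hypos, hyI.2⟩)
    rw [norm_mul] at i2
    have i4 : ‖deriv u y‖ * (‖(V y - E : ℂ)‖ * ‖u y‖) ≤ ‖deriv u y‖ * ((K + |E|) * ‖u y‖) := by
      gcongr
    have i5 : L * (2 * (‖u y‖ * ‖deriv u y‖)) ≤ L * N y := by
      gcongr
      linarith [two_mul_le_add_sq ‖u y‖ ‖deriv u y‖]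
    rw [hL] at i5 ⊢
    linarith
  calc ‖u x‖ ^ 2 ≤ N x := le_add_of_nonneg_right (by positivity)
    _ ≤ N a * Real.exp (L * (a - x)) := hback
    _ ≤ N a * Real.exp (L * a) := by
        have : 0 ≤ N a := by positivity
        gcongr
        linarith [hx.1]

theorem norm_sq_le_reflectionEnergy (hη : 0 < η) {x : ℝ} {r : ℂ} (hr : ‖r‖ ≤ 1 / 2) :
    ‖u x‖ ^ 2 ≤ 8 / η ^ 2 * reflectionEnergy (amplitude η u x) (amplitude (-η) u x) r := by
  have h := sq_add_sq_le_reflectionEnergy (a := amplitude η u x) (b := amplitude (-η) u x) hr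
  have h1 : η * ‖u x‖ ≤ ‖amplitude η u x‖ + ‖amplitude (-η) u x‖ := by
    have : amplitude η u x - amplitude (-η) u x = Complex.I * η * u x := by
      simp only [amplitude]
      push_cast
      ring
    calc η * ‖u x‖ = ‖Complex.I * η * u x‖ := by
          rw [norm_mul, norm_mul, Complex.norm_I, one_mul, Complex.norm_real,
            Real.norm_of_nonneg hη.le]
      _ ≤ _ := this ▸ norm_sub_le _ _
  have h2 : (η * ‖u x‖) ^ 2 ≤ (‖amplitude η u x‖ + ‖amplitude (-η) u x‖) ^ 2 := by gcongr
  rw [div_mul_eq_mul_div, le_div_iff₀ (by positivity)]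
  nlinarith [sq_nonneg (‖amplitude η u x‖ - ‖amplitude (-η) u x‖)]

end IsSchrodingerSolution

/-! ### Smooth interpolation on unit intervals. -/

/-- The smooth interpolation of the values of `f` at `a` and `a + 1`. -/
noncomputable def cosInterp (f : ℝ → ℂ) (a x : ℝ) : ℂ :=
  f a + ((1 - Real.cos (Real.pi * (x - a))) / 2 : ℝ) * (f (a + 1) - f a)

/-- The derivative of `cosInterp`. -/
noncomputable def cosInterpDeriv (f : ℝ → ℂ) (a x : ℝ) : ℂ :=
  (Real.pi / 2 * Real.sin (Real.pi * (x - a)) : ℝ) * (f (a + 1) - f a)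

theorem hasDerivAt_cosInterp (f : ℝ → ℂ) (a x : ℝ) :
    HasDerivAt (cosInterp f a) (cosInterpDeriv f a x) x := by
  have h1 : HasDerivAt (fun x : ℝ => (1 - Real.cos (Real.pi * (x - a))) / 2)
      (Real.pi / 2 * Real.sin (Real.pi * (x - a))) x := by
    refine ((((((hasDerivAt_id x).sub_const a).const_mul Real.pi).cos).const_sub 1).div_const
      2).congr_deriv ?_
    simp only [id]
    ring
  exact (h1.ofReal_comp.mul_const _).const_add _

theorem cosInterp_left (f : ℝ → ℂ) (a : ℝ) : cosInterp f a a = f a := by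
  simp [cosInterp]

theorem cosInterp_right (f : ℝ → ℂ) (a : ℝ) : cosInterp f a (a + 1) = f (a + 1) := by
  simp [cosInterp]

/-- The cosine weight lies in `[0, 1]` on the whole line, so the bounds are global, as termwise
differentiation of the series requires; an affine weight would be unbounded. -/
theorem cosInterp_mem_of_convex {s : Set ℂ} (hs : Convex ℝ s) {f : ℝ → ℂ} {a : ℝ}
    (h0 : f a ∈ s) (h1 : f (a + 1) ∈ s) (x : ℝ) : cosInterp f a x ∈ s := by
  have hc := Real.neg_one_le_cos (Real.pi * (x - a))
  have hc' := Real.cos_le_one (Real.pi * (x - a))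
  have h := hs.add_smul_sub_mem h0 h1 (t := (1 - Real.cos (Real.pi * (x - a))) / 2)
    ⟨by linarith, by linarith⟩
  rwa [Complex.real_smul] at h

theorem norm_cosInterpDeriv_le (f : ℝ → ℂ) (a x : ℝ) :
    ‖cosInterpDeriv f a x‖ ≤ 2 * ‖f (a + 1) - f a‖ := by
  rw [cosInterpDeriv, norm_mul, Complex.norm_real, norm_mul, Real.norm_eq_abs, Real.norm_eq_abs,
    abs_of_pos (by positivity)]
  gcongr
  have h1 := Real.abs_sin_le_one (Real.pi * (x - a))
  nlinarith [Real.pi_le_four, Real.pi_pos]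

/-! ### Assembling the bound. -/

theorem lemma1p3
    (V : ℝ → ℝ) (c : ℕ → ℂ) (φ : ℕ → ℝ) (γ : ℕ → ℝ → ℂ) (p : ℕ) (hp : 2 ≤ p)
    (η : ℝ) (hη : 0 < η)
    -- the potential
    (hV : ∀ x : ℝ, 0 < x →
      HasSum (fun k => c k * Complex.exp (-Complex.I * (φ k : ℂ) * (x : ℂ)) * γ k x) (V x : ℂ))
    -- uniformly bounded variation
    (hvar : ⨆ k, eVariationOn (γ k) (Ioi 0) < ∞)
    -- uniform `L^p` condition
    (hLp : ∫⁻ x in Ioi (0 : ℝ), (⨆ k, ‖γ k x‖ₑ) ^ p < ∞)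
    -- decay of coefficients
    (hc : Summable fun k => ‖c k‖)
    -- small divisor conditions
    (hsmall : ∀ j : ℕ, 1 ≤ j → j ≤ p - 1 → SmallDivisorCondition c φ η j)
    (u : ℝ → ℂ) (hu : IsSchrodingerSolution V (η ^ 2 / 4) u) :
    ∃ C : ℝ, ∀ x : ℝ, 0 < x → ‖u x‖ ≤ C := by
  obtain ⟨M, S, δ, hM, hS, hSM, hSp, hδ0, hδ, hγM, hγS, hγδ⟩ := exists_unit_interval_bounds hvar hLp
  obtain ⟨q, rfl⟩ : ∃ q, p = q + 1 := ⟨p - 1, by omega⟩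
  rw [Nat.add_sub_cancel] at hsmall
  have hδM : ∀ k n, δ k n ≤ M := fun k n =>
    (Finset.single_le_sum (f := δ k) (fun n _ => hδ0 k n) (Finset.self_mem_range_succ n)).trans
      (hδ k (n + 1))
  have hVK : ∀ x, 0 < x → |V x| ≤ (∑' k, ‖c k‖) * M := fun x hx => by
    rw [← Real.norm_eq_abs, ← Complex.norm_real, ← (hV x hx).tsum_eq]
    refine tsum_of_norm_bounded (hc.hasSum.mul_right M) fun k => ?_
    refine (norm_oscTerm c φ γ x k).trans_le ?_
    gcongr
    exact hγM k x hx
  obtain ⟨g, ρ, hg, hg0, hρ, hbound⟩ :=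
    exists_summable_riccatiDefect_bound hη hc hsmall hM hS hSM hSp hδ0 hδ
  set β : ℕ → ℕ → ℝ → ℂ := fun n k => cosInterp (γ k) (n + 1)
  set β' : ℕ → ℕ → ℝ → ℂ := fun n k => cosInterpDeriv (γ k) (n + 1)
  set r : ℕ → ℝ → ℂ := fun n x => riccatiSum η φ (oscTerm c φ (β n) x) q
  set ε : ℕ → ℝ → ℂ := fun n x =>
    riccatiDefect η φ (oscTerm c φ (β n) x) (oscTerm c φ (β' n) x) q (V x)
  have hl : ∀ n : ℕ, (n + 1 : ℝ) ∈ Icc (n + 1 : ℝ) (n + 2) := fun n => by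
    constructor <;> linarith
  have hr : ∀ n : ℕ, (n + 1 + 1 : ℝ) ∈ Icc (n + 1 : ℝ) (n + 2) := fun n => by
    constructor <;> linarith
  have hβS : ∀ n k x, ‖β n k x‖ ≤ S n + δ k n := fun n k x => by
    have := cosInterp_mem_of_convex (convex_closedBall (0 : ℂ) (S n + δ k n)) (f := γ k)
      (a := n + 1) (by simpa using hγS k n _ (hl n)) (by simpa using hγS k n _ (hr n)) x
    simpa using this
  have hβ'δ : ∀ n k x, ‖β' n k x‖ ≤ 2 * δ k n := fun n k x =>
    (norm_cosInterpDeriv_le _ _ _).trans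
      (mul_le_mul_of_nonneg_left (hγδ k n _ (hr n) _ (hl n)) zero_le_two)
  -- Both endpoint values lie in the ball of radius `δ k n` about `γ k x`, hence so does the
  -- interpolation.
  have hβγ : ∀ (n k : ℕ), ∀ x ∈ Icc (n + 1 : ℝ) (n + 2), ‖β n k x - γ k x‖ ≤ δ k n :=
      fun n k x hx => by
    have := cosInterp_mem_of_convex (convex_closedBall (γ k x) (δ k n)) (f := γ k) (a := n + 1)
      (by simpa [dist_eq_norm] using hγδ k n _ (hl n) x hx)
      (by simpa [dist_eq_norm] using hγδ k n _ (hr n) x hx) x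
    simpa [dist_eq_norm] using this
  have hpos : ∀ (n : ℕ), ∀ x ∈ Icc (n + 1 : ℝ) (n + 2), 0 < x := fun n x hx => by
    have := hx.1
    have : (0 : ℝ) ≤ n := n.cast_nonneg
    linarith
  have hsmallness : ∀ (n : ℕ), ∀ x ∈ Icc (n + 1 : ℝ) (n + 2), ‖r n x‖ ≤ ρ n ∧ ‖ε n x‖ ≤ g n := by
    intro n x hx
    refine hbound n _ _ _ (fun k => ?_) (fun k => ?_) ?_
    · rw [norm_oscTerm]
      gcongr
      exact hβS n k x
    · rw [norm_oscTerm]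
      gcongr
      exact hβ'δ n k x
    · have hs : Summable fun k => oscTerm c φ (β n) x k :=
        Summable.of_norm_bounded (hc.mul_right (2 * M)) fun k => by
          rw [norm_oscTerm]
          gcongr
          linarith [hβS n k x, hSM n, hδM k n]
      have hes := (summable_tsum_mul_of_sum_range_le (fun k => norm_nonneg (c k)) hc hδ0 hδ).1 n
      have hsub := hs.hasSum.sub (hV x (hpos n x hx))
      rw [← hsub.tsum_eq]
      refine tsum_of_norm_bounded hes.hasSum fun k => ?_
      have : oscTerm c φ (β n) x k -
          c k * Complex.exp (-Complex.I * (φ k : ℂ) * (x : ℂ)) * γ k x =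
          oscTerm c φ (fun k x => β n k x - γ k x) x k := by
        simp only [oscTerm]
        ring
      rw [this, norm_oscTerm]
      gcongr
      exact hβγ n k x hx
  have hderiv : ∀ n x, HasDerivAt (r n) (-Complex.I * η * r n x +
      Complex.I * V x * (η : ℂ)⁻¹ * (1 + r n x) ^ 2 + ε n x) x := fun n x =>
    hasDerivAt_riccatiSum (B := 2 * M) (by linarith) hc hsmall
      (fun k x => hasDerivAt_cosInterp (γ k) (n + 1) x)
      (fun k x => (hβS n k x).trans (by linarith [hSM n, hδM k n]))
      (fun k x => (hβ'δ n k x).trans (by linarith [hδM k n])) x (V x)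
  obtain ⟨N, hN⟩ := Filter.eventually_atTop.1 (hρ.eventually_le_const (u := 1 / 2) (by norm_num))
  set F : ℕ → ℝ → ℝ := fun n x => reflectionEnergy (IsSchrodingerSolution.amplitude η u x)
    (IsSchrodingerSolution.amplitude (-η) u x) (r n x)
  have hstep : ∀ n, N ≤ n → ∀ x ∈ Icc (n + 1 : ℝ) (n + 2),
      F n x ≤ F n (n + 1) * Real.exp (6 * g n) := fun n hn x hx => by
    have hsub : ∀ y ∈ Icc (n + 1 : ℝ) x, y ∈ Icc (n + 1 : ℝ) (n + 2) := fun y hy =>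
      ⟨hy.1, hy.2.trans hx.2⟩
    have h := hu.reflectionEnergy_le hη (hpos n _ (hl n)) hx.1 (fun y _ => hderiv n y)
      (fun y hy => (hsmallness n y (hsub y hy)).1.trans (hN n hn))
      (fun y hy => (hsmallness n y (hsub y hy)).2)
      (fun y hy => hVK y (hpos n y (hsub y hy)))
    have h0 : 0 ≤ F n (n + 1) := by
      have h1 := sq_add_sq_le_reflectionEnergy
        (a := IsSchrodingerSolution.amplitude η u (n + 1))
        (b := IsSchrodingerSolution.amplitude (-η) u (n + 1))
        ((hsmallness n _ (hl n)).1.trans (hN n hn))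
      have h2 : 0 ≤ 4 * F n (n + 1) := le_trans (by positivity) h1
      linarith
    refine h.trans (mul_le_mul_of_nonneg_left (Real.exp_le_exp.2 ?_) h0)
    exact mul_le_of_le_one_right (by linarith [hg0 n]) (by linarith [hx.2])
  -- Neighbouring interpolations agree at the common endpoint, so the energy does not jump there;
  -- agreement of derivatives is not needed.
  have hglue : ∀ n : ℕ, F (n + 1) ((n + 1 : ℕ) + 1) = F n (n + 1 + 1) := fun n => by
    have h1 : ∀ k, β (n + 1) k ((n + 1 : ℕ) + 1) = β n k (n + 1 + 1) := fun k => by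
      simp only [β]
      rw [cosInterp_left, cosInterp_right]
      push_cast
      rfl
    have h2 : oscTerm c φ (β (n + 1)) ((n + 1 : ℕ) + 1) = oscTerm c φ (β n) (n + 1 + 1) := by
      funext k
      simp only [oscTerm]
      rw [h1]
      push_cast
      rfl
    simp only [F, r, h2]
    push_cast
    rfl
  have hiter : ∀ m : ℕ, F (N + m) ((N + m : ℕ) + 1) ≤
      F N (N + 1) * Real.exp (6 * ∑ i ∈ Finset.range m, g (N + i)) := fun m => by
    induction m with
    | zero => simp
    | succ m ih =>
      calc F (N + m + 1) ((N + m + 1 : ℕ) + 1) = F (N + m) ((N + m : ℕ) + 1 + 1) := hglue (N + m)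
        _ ≤ F (N + m) ((N + m : ℕ) + 1) * Real.exp (6 * g (N + m)) :=
          hstep (N + m) (by omega) _ (hr (N + m))
        _ ≤ F N (N + 1) * Real.exp (6 * ∑ i ∈ Finset.range m, g (N + i)) *
              Real.exp (6 * g (N + m)) := by gcongr
        _ = _ := by
          rw [mul_assoc, ← Real.exp_add, Finset.sum_range_succ, mul_add]
  obtain ⟨C₀, hC₀⟩ := hu.exists_bound_near_zero (a := N + 1) (by positivity)
    fun x hx => hVK x hx.1
  set G := ∑' i, g i
  have hgG : ∀ m, ∑ i ∈ Finset.range m, g (N + i) + g (N + m) ≤ G := fun m => by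
    rw [← Finset.sum_range_succ (fun i => g (N + i)) m]
    calc ∑ i ∈ Finset.range (m + 1), g (N + i)
        ≤ ∑ i ∈ Finset.range N, g i + ∑ i ∈ Finset.range (m + 1), g (N + i) :=
          le_add_of_nonneg_left (Finset.sum_nonneg fun i _ => hg0 i)
      _ = ∑ i ∈ Finset.range (N + (m + 1)), g i := (Finset.sum_range_add _ _ _).symm
      _ ≤ G := hg.sum_le_tsum _ fun i _ => hg0 i
  refine ⟨max C₀ √(8 / η ^ 2 * (F N (N + 1) * Real.exp (6 * G))), fun x hx => ?_⟩
  rcases le_or_gt x (N + 1) with hxN | hxN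
  · exact (hC₀ x ⟨hx, hxN⟩).trans (le_max_left _ _)
  refine (Real.le_sqrt_of_sq_le ?_).trans (le_max_right _ _)
  obtain ⟨m, hm⟩ : ∃ m, ⌊x - 1⌋₊ = N + m :=
    Nat.exists_eq_add_of_le (Nat.le_floor (by linarith))
  have hx1 := Nat.floor_le (show 0 ≤ x - 1 by have : (0 : ℝ) ≤ N := N.cast_nonneg; linarith)
  have hx2 := Nat.lt_floor_add_one (x - 1)
  rw [hm] at hx1 hx2
  have hxI : x ∈ Icc ((N + m : ℕ) + 1 : ℝ) ((N + m : ℕ) + 2) := ⟨by linarith, by linarith⟩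
  have hF0 : 0 ≤ F N (N + 1) := by
    have h1 := sq_add_sq_le_reflectionEnergy
      (a := IsSchrodingerSolution.amplitude η u (N + 1))
      (b := IsSchrodingerSolution.amplitude (-η) u (N + 1))
      ((hsmallness N _ (hl N)).1.trans (hN N le_rfl))
    have h2 : 0 ≤ 4 * F N (N + 1) := le_trans (by positivity) h1
    linarith
  -- The last, possibly incomplete, interval contributes its own factor `exp (6 * g (N + m))`;
  -- together the exponents stay below `6 * G`.
  calc ‖u x‖ ^ 2 ≤ 8 / η ^ 2 * F (N + m) x :=
        IsSchrodingerSolution.norm_sq_le_reflectionEnergy hη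
          ((hsmallness _ x hxI).1.trans (hN _ (by omega)))
    _ ≤ 8 / η ^ 2 * (F N (N + 1) * Real.exp (6 * ∑ i ∈ Finset.range m, g (N + i)) *
          Real.exp (6 * g (N + m))) := by
        gcongr
        exact (hstep _ (by omega) x hxI).trans (by gcongr; exact hiter m)
    _ ≤ 8 / η ^ 2 * (F N (N + 1) * Real.exp (6 * G)) := by
        rw [mul_assoc (F N (N + 1)), ← Real.exp_add, ← mul_add]
        gcongr
        exact hgG m
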